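/- Consider the following problem: given $n\ge 1$ points $p_1,\dots,p_n$ in the Euclidean plane, find radii $r_1,\dots,r_n\ge 0$ (with no upper bound on the radii) of minimum sum $\sum_i r_i$ such that the disks of radius $r_i$ centred at $p_i$ are connected, i.e. such that the graph on $\{1,\dots,n\}$ in which $i\ne j$ are adjacent if and only if $|p_i-p_j|\le r_i+r_j$ is connected. Call radii satisfying these constraints feasible. This problem has a polynomial-time approximation scheme: there is a single program for the real RAM (unit-cost $+,-,\cdot,/$ and comparisons on real numbers, unit-cost addition, subtraction and comparison of nonnegative integers, indirect addressing, no rounding and no roots) which, given a real $\varepsilon>0$ and the points $p_1,\dots,p_n$, computes feasible radii $r_1,\dots,r_n$ with $$\sum_{i=1}^n r_i\le(1+\varepsilon)\sum_{i=1}^n r_i'\qquad\text{for all feasible } r_1',\dots,r_n',$$ and such that for every fixed $\varepsilon>0$ the number of steps is bounded by a polynomial in $n$ (which may depend on $\varepsilon$). -/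

import Mathlib

/-! ### The connected range assignment problem -/

/-- The connectivity graph of the disks of radii `r i` centred at the points `P i`: two different
indices are adjacent when the distance of the centres is at most the sum of the radii, that is,
when the two disks intersect. -/
def connectivityGraph {n : ℕ} (P : Fin n → EuclideanSpace ℝ (Fin 2)) (r : Fin n → ℝ) :
    SimpleGraph (Fin n) where
  Adj i j := i ≠ j ∧ dist (P i) (P j) ≤ r i + r j
  symm := ⟨fun i j h => ⟨h.1.symm, by rw [dist_comm, add_comm]; exact h.2⟩⟩
  loopless := ⟨fun _ h => h.1 rfl⟩

/-- Feasible solutions: nonnegative radii, not bounded from above, with a connected graph. -/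
def IsFeasible {n : ℕ} (P : Fin n → EuclideanSpace ℝ (Fin 2)) (r : Fin n → ℝ) : Prop :=
  (∀ i, 0 ≤ r i) ∧ (connectivityGraph P r).Connected

/-! ### The real random access machine -/

namespace RealRAM

/-- A state of the machine: index (natural number) registers, real registers, an index memory and
a real memory. A program names only finitely many registers; memory cells are accessed through an
address held in an index register. -/
structure State where
  idx : ℕ → ℕ
  reg : ℕ → ℝ
  imem : ℕ → ℕ
  rmem : ℕ → ℝ

/-- The elementary instructions. Index registers can be set, copied, added and subtracted
(truncated at `0`), but not multiplied; real registers can be set to an integer constant, copied,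
added, subtracted, multiplied and divided. There is no rounding, no root, and no transfer from real
numbers to indices other than by comparisons. -/
inductive Instr
  | iconst (a : ℕ) (c : ℕ)
  | imove (a b : ℕ)
  | iadd (a b c : ℕ)
  | isub (a b c : ℕ)
  | iload (a b : ℕ)
  | istore (a b : ℕ)
  | rconst (a : ℕ) (c : ℤ)
  | rmove (a b : ℕ)
  | radd (a b c : ℕ)
  | rsub (a b c : ℕ)
  | rmul (a b c : ℕ)
  | rdiv (a b c : ℕ)
  | rload (a b : ℕ)
  | rstore (a b : ℕ)

open Function in
/-- The effect of an instruction. The first argument of an instruction is its target; for the two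
store instructions it is the index register that holds the address of the target cell. Division by
zero yields zero (a program can test a divisor beforehand). -/
noncomputable def Instr.apply : Instr → State → State
  | iconst a c, s => { s with idx := update s.idx a c }
  | imove a b, s => { s with idx := update s.idx a (s.idx b) }
  | iadd a b c, s => { s with idx := update s.idx a (s.idx b + s.idx c) }
  | isub a b c, s => { s with idx := update s.idx a (s.idx b - s.idx c) }
  | iload a b, s => { s with idx := update s.idx a (s.imem (s.idx b)) }
  | istore a b, s => { s with imem := update s.imem (s.idx a) (s.idx b) }
  | rconst a c, s => { s with reg := update s.reg a (c : ℝ) }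
  | rmove a b, s => { s with reg := update s.reg a (s.reg b) }
  | radd a b c, s => { s with reg := update s.reg a (s.reg b + s.reg c) }
  | rsub a b c, s => { s with reg := update s.reg a (s.reg b - s.reg c) }
  | rmul a b c, s => { s with reg := update s.reg a (s.reg b * s.reg c) }
  | rdiv a b c, s => { s with reg := update s.reg a (s.reg b / s.reg c) }
  | rload a b, s => { s with reg := update s.reg a (s.rmem (s.idx b)) }
  | rstore a b, s => { s with rmem := update s.rmem (s.idx a) (s.reg b) }

/-- Comparisons of two index registers or of two real registers. -/
inductive Test
  | ile (a b : ℕ)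
  | rle (a b : ℕ)

def Test.Holds : Test → State → Prop
  | ile a b, s => s.idx a ≤ s.idx b
  | rle a b, s => s.reg a ≤ s.reg b

/-- Structured programs. -/
inductive Prog
  | skip
  | instr (i : Instr)
  | seq (p q : Prog)
  | cond (t : Test) (p q : Prog)
  | loop (t : Test) (p : Prog)

/-- `Exec p s s' k`: started in state `s`, the program `p` halts in state `s'` after exactly `k`
steps, where every instruction and every evaluation of a test is one step. -/
inductive Exec : Prog → State → State → ℕ → Prop
  | skip (s : State) : Exec .skip s s 1
  | instr (i : Instr) (s : State) : Exec (.instr i) s (i.apply s) 1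
  | seq {p q : Prog} {s s' s'' : State} {k l : ℕ} :
      Exec p s s' k → Exec q s' s'' l → Exec (.seq p q) s s'' (k + l)
  | cond_true {t : Test} {p q : Prog} {s s' : State} {k : ℕ} :
      t.Holds s → Exec p s s' k → Exec (.cond t p q) s s' (k + 1)
  | cond_false {t : Test} {p q : Prog} {s s' : State} {k : ℕ} :
      ¬ t.Holds s → Exec q s s' k → Exec (.cond t p q) s s' (k + 1)
  | loop_done {t : Test} {p : Prog} {s : State} :
      ¬ t.Holds s → Exec (.loop t p) s s 1
  | loop_step {t : Test} {p : Prog} {s s' s'' : State} {k l : ℕ} :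
      t.Holds s → Exec p s s' k → Exec (.loop t p) s' s'' l →
        Exec (.loop t p) s s'' (k + l + 1)

/-- A program has at most one halting computation from a given state. -/
theorem Exec.deterministic {p : Prog} {s s₁ : State} {k : ℕ} (h : Exec p s s₁ k) :
    ∀ {s₂ : State} {l : ℕ}, Exec p s s₂ l → s₁ = s₂ ∧ k = l := by
  induction h with
  | skip s => intro _ _ h'; cases h'; exact ⟨rfl, rfl⟩
  | instr i s => intro _ _ h'; cases h'; exact ⟨rfl, rfl⟩
  | seq _ _ ih₁ ih₂ =>
    intro _ _ h'
    cases h' with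
    | seq a b =>
      obtain ⟨rfl, rfl⟩ := ih₁ a
      obtain ⟨rfl, rfl⟩ := ih₂ b
      exact ⟨rfl, rfl⟩
  | cond_true ht _ ih =>
    intro _ _ h'
    cases h' with
    | cond_true _ a => obtain ⟨rfl, rfl⟩ := ih a; exact ⟨rfl, rfl⟩
    | cond_false hf _ => exact absurd ht hf
  | cond_false hf _ ih =>
    intro _ _ h'
    cases h' with
    | cond_true ht _ => exact absurd ht hf
    | cond_false _ a => obtain ⟨rfl, rfl⟩ := ih a; exact ⟨rfl, rfl⟩
  | loop_done hf =>
    intro _ _ h'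
    cases h' with
    | loop_done _ => exact ⟨rfl, rfl⟩
    | loop_step ht _ _ => exact absurd ht hf
  | loop_step ht _ _ ih₁ ih₂ =>
    intro _ _ h'
    cases h' with
    | loop_done hf => exact absurd ht hf
    | loop_step _ a b =>
      obtain ⟨rfl, rfl⟩ := ih₁ a
      obtain ⟨rfl, rfl⟩ := ih₂ b
      exact ⟨rfl, rfl⟩

/-- The initial state for the points `P 0, …, P (n - 1)` and the accuracy `ε`: index register `0`
holds `n`, real register `0` holds `ε`, the cells `2 * i` and `2 * i + 1` of the real memory hold
the two coordinates of `P i`, and everything else is zero. -/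
noncomputable def inputState {n : ℕ} (P : Fin n → EuclideanSpace ℝ (Fin 2)) (ε : ℝ) : State where
  idx a := if a = 0 then n else 0
  reg a := if a = 0 then ε else 0
  imem _ := 0
  rmem a := if h : a / 2 < n then P ⟨a / 2, h⟩ ⟨a % 2, Nat.mod_lt a two_pos⟩ else 0

/-- The radii returned in a final state: the `n` cells of the real memory after the input. -/
def output (n : ℕ) (s : State) : Fin n → ℝ :=
  fun i => s.rmem (2 * n + i)

end RealRAM

/-! ### Sparse solutions -/

/-! Two facts make exhaustive search affordable: near-optimal radii can be taken with boundedly many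
nonzero entries, and they can then be rounded to a coarse grid.

Sparsity (`IsFeasible.exists_sparse`): let `tot` be the cost of a solution. There is a set `A` of
bounded size outside of which no moderately small set of disks carries more than `tot / q`
(`exists_dominating_set`). Remove `A` and look at the remaining components. A component of weight
`S` lies in one disk of radius `S + r c` around its weighted centroid `c`. This replacement is made
for one component per pair of disks of `A` that have a common neighbouring component, and for all
heavy components. These are few, so the terms `r c` sum to at most `tot / q`. Every other component
is light and touches `A`, so a slight enlargement of the disks of `A` covers it, at total cost `tot
/ q`. The result costs at most `(1 + 2 / q) * tot`.

Rounding (`IsExtent.exists_grid_approx`): the extent `M` of the points is at most twice the optimum,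
so rounding boundedly many radii up to multiples of a constant fraction of `M` costs another `2 /
q`.

Search (`runs_search`): a vector of multiplicities of the unit is coded by a bijective base-`n`
numeral whose length is the total number of units. Counting upwards lists the vectors by
nondecreasing cost, so the first connected trial is optimal on the grid. One big disk is feasible
with a number of units independent of `n`, so polynomially many trials suffice. -/

/-- The finite vertex sets that arise from a single vertex by adding neighbours one at a time. -/
inductive SimpleGraph.Grown {V : Type*} [DecidableEq V] (G : SimpleGraph V) : Finset V → Prop
  | single (v : V) : G.Grown {v}
  | grow {C : Finset V} {p l : V} : G.Grown C → p ∈ C → l ∉ C → G.Adj p l → G.Grown (insert l C)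

namespace SimpleGraph

variable {V : Type*} [DecidableEq V]

/-- A largest grown subset of the component must be all of it: otherwise a walk to a missing vertex
leaves the subset along an edge, and the outer end of that edge could be added. -/
theorem Grown.of_reachable [Fintype V] {G : SimpleGraph V} {C : Finset V} {c : V} (hc : c ∈ C)
    (hC : ∀ v, v ∈ C ↔ G.Reachable c v) : G.Grown C := by
  classical
  let F := C.powerset.filter fun B => G.Grown B
  have hF : F.Nonempty := ⟨{c}, by simp [F, hc, Grown.single]⟩
  obtain ⟨B, hB, hmax⟩ := F.exists_max_image Finset.card hF
  simp only [F, Finset.mem_filter, Finset.mem_powerset] at hB hmax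
  by_cases h : C ⊆ B
  · rw [Finset.Subset.antisymm h hB.1]; exact hB.2
  obtain ⟨v, hv, hvB⟩ := Finset.not_subset.1 h
  have hne : ∃ b, b ∈ B := by
    cases hB.2 with
    | single v => exact ⟨v, by simp⟩
    | grow _ h' _ _ => exact ⟨_, Finset.mem_insert_of_mem h'⟩
  obtain ⟨b, hb⟩ := hne
  obtain ⟨w⟩ : G.Reachable b v := ((hC b).1 (hB.1 hb)).symm.trans ((hC v).1 hv)
  obtain ⟨d, -, hd, hd'⟩ := w.exists_boundary_dart (B : Set V) hb hvB
  have hdC : d.snd ∈ C := (hC _).2 (((hC _).1 (hB.1 hd)).trans d.adj.reachable)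
  have := hmax (insert d.snd B) ⟨Finset.insert_subset hdC hB.1, hB.2.grow hd hd' d.adj⟩
  rw [Finset.card_insert_of_notMem hd'] at this
  omega

/-- A vertex-weighted path distance is at most the total weight. -/
theorem Grown.le_sum {G : SimpleGraph V} {C : Finset V} (hC : G.Grown C) {r : V → ℝ}
    {D : V → V → ℝ} (hr : ∀ v, 0 ≤ r v) (hs : ∀ u v, D u v = D v u) (h0 : ∀ v, D v v ≤ r v)
    (h1 : ∀ u v w, G.Adj u v → D w v ≤ D w u + r v) :
    ∀ u ∈ C, ∀ v ∈ C, D u v ≤ ∑ i ∈ C, r i := by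
  induction hC with
  | single v => simpa using h0 v
  | @grow C p l _ hp hl hpl ih =>
    have key : ∀ u ∈ C, D u l ≤ r l + ∑ i ∈ C, r i := fun u hu => by
      linarith [h1 p l u hpl, ih u hu p hp]
    have hC0 : 0 ≤ ∑ i ∈ C, r i := Finset.sum_nonneg fun i _ => hr i
    intro u hu v hv
    rw [Finset.sum_insert hl]
    rcases Finset.mem_insert.1 hu with hul | hu' <;> rcases Finset.mem_insert.1 hv with hvl | hv'
    · rw [hul, hvl]; linarith [h0 l]
    · rw [hul, hs]; exact key v hv'
    · rw [hvl]; exact key u hu'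
    · linarith [ih u hu' v hv', hr l]

/-- A weighted centroid: some vertex is within half the total weight, plus its own weight, of all
others. -/
theorem Grown.exists_centroid {G : SimpleGraph V} {C : Finset V} (hC : G.Grown C) :
    ∀ {r : V → ℝ} {D : V → V → ℝ}, (∀ v, 0 ≤ r v) → (∀ u v, D u v = D v u) →
    (∀ v, D v v ≤ r v) → (∀ u v w, G.Adj u v → D w v ≤ D w u + r v) →
    ∃ c ∈ C, ∀ v ∈ C, D c v ≤ r c + (∑ i ∈ C, r i) / 2 := by
  induction hC with
  | single v =>
    intro r D hr _ h0 _
    refine ⟨v, by simp, ?_⟩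
    simpa using (h0 v).trans (by linarith [hr v])
  | @grow C p l hC hp hl hpl ih =>
    intro r D hr hs h0 h1
    have hne : l ≠ p := fun h => hl (h ▸ hp)
    have hsum : ∑ i ∈ C, Function.update r p (r p + r l) i = r l + ∑ i ∈ C, r i := by
      rw [← Finset.add_sum_erase _ _ hp, ← Finset.add_sum_erase _ _ hp,
        Finset.sum_congr rfl fun i hi => Function.update_of_ne (Finset.ne_of_mem_erase hi) _ _]
      simp; ring
    -- The leaf `l` is contracted into its neighbour `p`: its weight moves to `p`, and distances
    -- involving `p` grow by `r l`, so that being close to `p` now includes being close to `l`. The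
    -- total weight is unchanged.
    obtain ⟨c, hc, h⟩ := ih (r := Function.update r p (r p + r l))
      (D := fun u v => D u v + if u = p ∨ v = p then r l else 0)
      (fun v => by
        by_cases hv : v = p
        · subst hv; simpa using add_nonneg (hr v) (hr l)
        · simpa [hv] using hr v)
      (fun u v => by rw [hs u v]; simp only [or_comm])
      (fun v => by
        by_cases hv : v = p
        · subst hv; simpa using h0 v
        · simpa [hv] using h0 v)
      (fun u v w huv => by
        have := h1 u v w huv
        have := hr l
        simp only [Function.update_apply]
        split_ifs <;> subst_vars <;> first | linarith | simp_all)
    rw [hsum] at h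
    rw [Finset.sum_insert hl]
    by_cases hcp : c = p
    · subst hcp
      simp only [true_or, if_true, Function.update_self] at h
      -- Only the bound for `l` itself can fail at `c = p`, and only if `l` has more than half of
      -- the weight. Then `l` is a centroid, since all distances are at most the total.
      by_cases hhalf : r l ≤ (r l + ∑ i ∈ C, r i) / 2
      · refine ⟨c, Finset.mem_insert_of_mem hc, fun v hv => ?_⟩
        rcases Finset.mem_insert.1 hv with rfl | hv
        · linarith [h1 c v c hpl, h0 c]
        · linarith [h v hv]
      · refine ⟨l, Finset.mem_insert_self _ _, fun v hv => ?_⟩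
        have := (hC.grow hp hl hpl).le_sum hr hs h0 h1 l (Finset.mem_insert_self _ _) v hv
        rw [Finset.sum_insert hl] at this
        linarith
    · refine ⟨c, Finset.mem_insert_of_mem hc, fun v hv => ?_⟩
      simp only [hcp, false_or, ne_eq, not_false_eq_true, Function.update_of_ne] at h
      rcases Finset.mem_insert.1 hv with rfl | hv
      · have := h p hp
        simp only [if_true] at this
        linarith [h1 p v c hpl]
      · have := h v hv
        have : 0 ≤ if v = p then r l else 0 := by split_ifs <;> simp [hr l]
        linarith

end SimpleGraph

/-! ### Replacing a solution by one with few nonzero radii -/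

section Sparse

variable {n : ℕ} {P : Fin n → EuclideanSpace ℝ (Fin 2)} {r : Fin n → ℝ}

/-- The size bound for sparse solutions of accuracy `1 / q`. -/
def sparseBound (q : ℕ) : ℕ → ℕ
  | 0 => 1
  | j + 1 => sparseBound q j + (sparseBound q j ^ 2 + 2 * q * sparseBound q j)

theorem sparseBound_pos (q j : ℕ) : 0 < sparseBound q j := by
  induction j with
  | zero => simp [sparseBound]
  | succ j ih => simp only [sparseBound]; omega

theorem sparseBound_mono (q : ℕ) : Monotone (sparseBound q) :=
  monotone_nat_of_le_succ fun j => by simp only [sparseBound]; omega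

/-- A small set outside of which no small set has a large sum. -/
theorem exists_dominating_set {V : Type*} [Fintype V] [DecidableEq V] (v₀ : V) {r : V → ℝ}
    (hr : ∀ v, 0 ≤ r v) {q : ℕ} (hq : 0 < q) :
    ∃ A : Finset V, A.Nonempty ∧ A.card ≤ sparseBound q q ∧
      ∀ T : Finset V, Disjoint T A → T.card ≤ A.card ^ 2 + 2 * q * A.card →
        ∑ v ∈ T, r v ≤ (∑ v, r v) / q := by
  by_contra! hcon
  have hq' : (0 : ℝ) < q := by exact_mod_cast hq
  -- If no set worked, each round could add a set of weight more than `tot / q`. After `q` rounds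
  -- everything is used up, and one more round is a contradiction. The recursion of `sparseBound` is
  -- the growth in one round.
  have step : ∀ j ≤ q, ∃ A : Finset V, A.Nonempty ∧ A.card ≤ sparseBound q j ∧
      j * ((∑ v, r v) / q) ≤ ∑ v ∈ A, r v := by
    intro j
    induction j with
    | zero => exact fun _ => ⟨{v₀}, by simp, by simp [sparseBound], by simp [hr]⟩
    | succ j ih =>
      intro hj
      obtain ⟨A, hA, hcard, hsum⟩ := ih (by omega)
      obtain ⟨T, hT, hTc, hTs⟩ := hcon A hA (hcard.trans (sparseBound_mono q (by omega)))
      refine ⟨T ∪ A, hA.mono Finset.subset_union_right, ?_, ?_⟩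
      · rw [Finset.card_union_of_disjoint hT]
        have : A.card ^ 2 ≤ sparseBound q j ^ 2 := Nat.pow_le_pow_left hcard 2
        have : 2 * q * A.card ≤ 2 * q * sparseBound q j := Nat.mul_le_mul_left _ hcard
        simp only [sparseBound]; omega
      · rw [Finset.sum_union hT]; push_cast; linarith
  obtain ⟨A, hA, hcard, hsum⟩ := step q le_rfl
  obtain ⟨T, hT, -, hTs⟩ := hcon A hA hcard
  rw [mul_div_cancel₀ _ hq'.ne'] at hsum
  have h1 : ∑ v ∈ T, r v + ∑ v ∈ A, r v ≤ ∑ v, r v := by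
    rw [← Finset.sum_union hT]
    exact Finset.sum_le_sum_of_subset_of_nonneg (Finset.subset_univ _) fun i _ _ => hr i
  have : 0 ≤ (∑ v, r v) / q := div_nonneg (Finset.sum_nonneg fun i _ => hr i) hq'.le
  linarith

open Classical in
/-- The connected components that are left when the vertices in `A` are removed from `G` carry
centres, and all distances inside are controlled by the radii. -/
theorem exists_component_centers (hr : ∀ i, 0 ≤ r i) (A : Finset (Fin n)) :
    ∃ (H : Setoid (Fin n)) (c : Fin n → Fin n),
      (∀ u v, (connectivityGraph P r).Adj u v → u ∉ A → v ∉ A → H u v) ∧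
      (∀ u v, H u v → u ∉ A → v ∉ A) ∧
      (∀ u v, H u v → c u = c v) ∧ (∀ u, H u (c u)) ∧
      (∀ (S : Fin n → ℝ), (∀ u, S u = ∑ i with H u i, r i) →
        (∀ u v, H u v → dist (P (c u)) (P v) + r v ≤ S u + r (c u)) ∧
        (∀ u v, H u v → dist (P u) (P v) + r u + r v ≤ 2 * S u)) := by
  classical
  let G := connectivityGraph P r
  let H : SimpleGraph (Fin n) :=
    { Adj := fun u v => G.Adj u v ∧ u ∉ A ∧ v ∉ A
      symm := ⟨fun u v h => ⟨h.1.symm, h.2.2, h.2.1⟩⟩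
      loopless := ⟨fun _ h => h.1.ne rfl⟩ }
  -- Along a walk the distances are bounded by sums of consecutive radii, which count inner radii
  -- twice and end radii once. Adding the end radii and halving therefore gives a quantity bounded
  -- by the vertex weight of the walk.
  let D : Fin n → Fin n → ℝ := fun u v => (dist (P u) (P v) + r u + r v) / 2
  have hs : ∀ u v, D u v = D v u := fun u v => by simp only [D, dist_comm]; ring
  have h0 : ∀ v, D v v ≤ r v := fun v => by simp [D]
  have h1 : ∀ u v w, H.Adj u v → D w v ≤ D w u + r v := fun u v w h => by
    have := dist_triangle (P w) (P u) (P v)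
    have := h.1.2
    simp only [D]; linarith
  have hgrown : ∀ C : H.ConnectedComponent,
      H.Grown (Finset.univ.filter fun v => H.connectedComponentMk v = C) := fun C => by
    induction C using SimpleGraph.ConnectedComponent.ind with
    | h c =>
      refine SimpleGraph.Grown.of_reachable (c := c) (by simp) fun v => ?_
      simp only [Finset.mem_filter, Finset.mem_univ, true_and, SimpleGraph.ConnectedComponent.eq]
      exact SimpleGraph.reachable_comm
  choose c hc hcv using fun C => (hgrown C).exists_centroid hr hs h0 h1
  simp only [Finset.mem_filter, Finset.mem_univ, true_and] at hc hcv
  refine ⟨H.reachableSetoid, fun u => c (H.connectedComponentMk u), ?_, ?_, ?_, ?_, ?_⟩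
  · intro u v h hu hv
    exact SimpleGraph.Adj.reachable (G := H) ⟨h, hu, hv⟩
  · rintro u v ⟨w⟩ hu hv
    cases w.reverse with
    | nil => exact hu hv
    | cons h _ => exact h.2.1 hv
  · intro u v h
    have : H.connectedComponentMk u = H.connectedComponentMk v :=
      SimpleGraph.ConnectedComponent.eq.2 h
    simp only [this]
  · intro u
    exact (SimpleGraph.ConnectedComponent.eq.1 (hc _)).symm
  · intro S hS
    have hS' : ∀ u, S u = ∑ i with H.connectedComponentMk i = H.connectedComponentMk u, r i := by
      intro u
      rw [hS]
      refine Finset.sum_congr (Finset.filter_congr fun i _ => ?_) fun _ _ => rfl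
      rw [SimpleGraph.ConnectedComponent.eq, SimpleGraph.reachable_comm]
      rfl
    constructor
    · intro u v h
      have := hcv (H.connectedComponentMk u) v (SimpleGraph.ConnectedComponent.eq.2 h.symm)
      rw [← hS'] at this
      simp only [D] at this
      linarith
    · intro u v h
      have := (hgrown (H.connectedComponentMk u)).le_sum hr hs h0 h1 u (by simp) v
        (by simpa using SimpleGraph.ConnectedComponent.eq.2 h.symm)
      rw [← hS'] at this
      simp only [D] at this
      linarith

open Classical in
/-- At most `m` classes of an equivalence relation have more than the `m`-th part of the sum. -/
theorem card_heavy_le {V : Type*} [Fintype V] (H : Setoid V) {r : V → ℝ}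
    (hr : ∀ v, 0 ≤ r v) {c : V → V} (hc : ∀ u v, H u v → c u = c v) (m : ℕ)
    (T : Finset V) (hT : ∀ v ∈ T, c v = v ∧ ∑ i, r i < m * ∑ i with H v i, r i) :
    T.card ≤ m := by
  by_contra! hcard
  have hS : 0 ≤ ∑ i, r i := Finset.sum_nonneg fun i _ => hr i
  have h1 : ∑ v ∈ T, ∑ i with H v i, r i ≤ ∑ i, r i := by
    rw [← Finset.sum_biUnion]
    · exact Finset.sum_le_sum_of_subset_of_nonneg (Finset.subset_univ _) fun i _ _ => hr i
    · intro u hu v hv huv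
      rw [Function.onFun, Finset.disjoint_left]
      intro i hi hi'
      simp only [Finset.mem_filter, Finset.mem_univ, true_and] at hi hi'
      exact huv (by rw [← (hT u hu).1, ← (hT v hv).1, hc u i hi, hc v i hi'])
  have hne : T.Nonempty := Finset.card_pos.1 (by omega)
  have h2 : ∑ _v ∈ T, ∑ i, r i < ∑ v ∈ T, m * ∑ i with H v i, r i :=
    Finset.sum_lt_sum_of_nonempty hne fun v hv => (hT v hv).2
  rw [← Finset.mul_sum, Finset.sum_const, nsmul_eq_mul] at h2
  have h3 : (m : ℝ) * ∑ v ∈ T, ∑ i with H v i, r i ≤ m * ∑ i, r i :=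
    mul_le_mul_of_nonneg_left h1 (Nat.cast_nonneg m)
  have h4 : (m : ℝ) * ∑ i, r i ≤ T.card * ∑ i, r i :=
    mul_le_mul_of_nonneg_right (by exact_mod_cast hcard.le) hS
  linarith

/-- Every solution can be replaced by one of almost the same cost that has a bounded number of
nonzero radii. -/
theorem IsFeasible.exists_sparse (h : IsFeasible P r) {q : ℕ} (hq : 0 < q) :
    ∃ r', IsFeasible P r' ∧ (Finset.univ.filter fun i => r' i ≠ 0).card ≤ sparseBound q (q + 1) ∧
      ∑ i, r' i ≤ (1 + 2 / q) * ∑ i, r i := by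
  classical
  obtain ⟨hr, hG⟩ := h
  have hq' : (0 : ℝ) < q := by exact_mod_cast hq
  obtain ⟨v₀⟩ := hG.nonempty
  obtain ⟨A, ⟨a₀, ha₀⟩, hAcard, hA⟩ := exists_dominating_set v₀ hr hq
  obtain ⟨H, c, hadj, hHA, hc, hcH, hS⟩ := exists_component_centers (P := P) hr A
  obtain ⟨hstar, hdiam⟩ := hS _ fun _ => rfl
  set G := connectivityGraph P r
  set tot := ∑ i, r i with htot
  set S : Fin n → ℝ := fun u => ∑ i with H u i, r i with hSdef
  have htot0 : 0 ≤ tot := Finset.sum_nonneg fun i _ => hr i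
  have hcc : ∀ u, c (c u) = c u := fun u => (hc _ _ (hcH u)).symm
  have hcA : ∀ u, u ∉ A → c u ∉ A := fun u => hHA _ _ (hcH u)
  -- With this threshold, enlarging all disks of `A` by `2 * tot / m` costs exactly `tot / q`.
  obtain ⟨m, hmdef⟩ : ∃ m, m = 2 * q * A.card := ⟨_, rfl⟩
  have hApos : 0 < A.card := Finset.card_pos.2 ⟨a₀, ha₀⟩
  have hm : (0 : ℝ) < m := by
    have : 0 < m := by rw [hmdef]; positivity
    exact_mod_cast this
  -- the components are represented by their centres
  let touch : Fin n → Fin n → Prop := fun a z => a ∈ A ∧ ∃ v, v ∉ A ∧ c v = z ∧ G.Adj a v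
  -- The default `a₀` lies in `A`, so the filter in `sel` discards it.
  let link : Fin n × Fin n → Fin n := fun e =>
    if h : ∃ z, touch e.1 z ∧ touch e.2 z then h.choose else a₀
  let heavy := Finset.univ.filter fun v => v ∉ A ∧ c v = v ∧ tot < m * S v
  let sel := ((A ×ˢ A).image link).filter (fun v => v ∉ A ∧ c v = v) ∪ heavy
  have hsel : ∀ z ∈ sel, z ∉ A ∧ c z = z := by
    intro z hz
    rcases Finset.mem_union.1 hz with hz | hz
    · exact (Finset.mem_filter.1 hz).2
    · have := (Finset.mem_filter.1 hz).2
      exact ⟨this.1, this.2.1⟩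
  have hselcard : sel.card ≤ A.card ^ 2 + m := by
    refine (Finset.card_union_le _ _).trans (Nat.add_le_add ?_ ?_)
    · refine (Finset.card_filter_le _ _).trans (Finset.card_image_le.trans ?_)
      rw [Finset.card_product, sq]
    · refine card_heavy_le H hr hc m heavy fun v hv => ?_
      exact (Finset.mem_filter.1 hv).2.2
  have hselA : Disjoint sel A := Finset.disjoint_left.2 fun z hz => (hsel z hz).1
  have hselsum := hA sel hselA (hmdef ▸ hselcard)
  obtain ⟨r', hr'⟩ : ∃ r' : Fin n → ℝ, ∀ v, r' v =
      if v ∈ A then r v + 2 * tot / m else if v ∈ sel then S v + r v else 0 := ⟨_, fun _ => rfl⟩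
  have hr'A : ∀ v ∈ A, r' v = r v + 2 * tot / m := fun v hv => by rw [hr', if_pos hv]
  have hr's : ∀ v ∈ sel, r' v = S v + r v := fun v hv => by
    rw [hr', if_neg (hsel v hv).1, if_pos hv]
  have hr'n : ∀ v, v ∉ A → v ∉ sel → r' v = 0 := fun v hv hv' => by
    rw [hr', if_neg hv, if_neg hv']
  have hS0 : ∀ v, 0 ≤ S v := fun v => Finset.sum_nonneg fun i _ => hr i
  have hm0 : 0 ≤ 2 * tot / m := by positivity
  have hr'0 : ∀ v, 0 ≤ r' v := fun v => by
    have := hr v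
    have := hS0 v
    rw [hr']; split_ifs <;> linarith
  refine ⟨r', ⟨hr'0, ?_⟩, ?_, ?_⟩
  · let G' := connectivityGraph P r'
    have htouch : ∀ a z, touch a z → z ∈ sel → G'.Adj a z := by
      rintro a z ⟨ha, v, hv, rfl, hav⟩ hz
      refine ⟨fun h => (hsel _ hz).1 (h ▸ ha), ?_⟩
      rw [hr'A a ha, hr's _ hz]
      have h1 := hstar (c v) v (H.symm (hcH v))
      rw [hcc] at h1
      have h2 := hav.2
      have h3 := dist_triangle (P a) (P v) (P (c v))
      rw [dist_comm (P v)] at h3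
      linarith
    have hlink : ∀ a b z, touch a z → touch b z → G'.Reachable a b := by
      intro a b z ha hb
      have hex : ∃ z, touch (a, b).1 z ∧ touch (a, b).2 z := ⟨z, ha, hb⟩
      have hl : link (a, b) = hex.choose := dif_pos hex
      obtain ⟨h1, h2⟩ := hex.choose_spec
      rw [← hl] at h1 h2
      have hmem : link (a, b) ∈ sel := by
        refine Finset.mem_union_left _ (Finset.mem_filter.2
          ⟨Finset.mem_image_of_mem _ (Finset.mk_mem_product ha.1 hb.1), ?_⟩)
        obtain ⟨-, v, hv, hcv, -⟩ := h1
        rw [← hcv]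
        exact ⟨hcA v hv, hcc v⟩
      exact (htouch _ _ h1 hmem).reachable.trans (htouch _ _ h2 hmem).symm.reachable
    -- A walk that enters a component from `a ∈ A` and leaves it to `b ∈ A` can be rerouted through
    -- the component selected for the pair `(a, b)`, which need not be the same one.
    have hwalk : ∀ v, Relation.ReflTransGen G.Adj a₀ v → (v ∈ A → G'.Reachable a₀ v) ∧
        (v ∉ A → ∃ a, touch a (c v) ∧ G'.Reachable a₀ a) := by
      intro v hv
      induction hv with
      | refl => exact ⟨fun _ => .rfl, fun h => absurd ha₀ h⟩
      | @tail u v _ huv ih =>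
        by_cases hu : u ∈ A
        · refine ⟨fun hv => (ih.1 hu).trans (SimpleGraph.Adj.reachable ⟨huv.ne, ?_⟩), fun hv =>
            ⟨u, ⟨hu, v, hv, rfl, huv⟩, ih.1 hu⟩⟩
          rw [hr'A u hu, hr'A v hv]
          have := huv.2
          linarith
        · obtain ⟨a, ha, hr⟩ := ih.2 hu
          refine ⟨fun hv => hr.trans (hlink a v (c u) ha ⟨hv, u, hu, rfl, huv.symm⟩), fun hv =>
            ⟨a, ?_, hr⟩⟩
          rwa [← hc u v (hadj u v huv hu hv)]
    have hall : ∀ v, G'.Reachable a₀ v := by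
      intro v
      have := hwalk v ((SimpleGraph.reachable_iff_reflTransGen _ _).1 (hG.preconnected a₀ v))
      by_cases hv : v ∈ A
      · exact this.1 hv
      obtain ⟨a, ha, hra⟩ := this.2 hv
      by_cases hz : c v ∈ sel
      · refine hra.trans ((htouch _ _ ha hz).reachable.trans ?_)
        by_cases hvc : c v = v
        · rw [hvc]
        · refine SimpleGraph.Adj.reachable ⟨hvc, ?_⟩
          have h1 := hstar (c v) v (H.symm (hcH v))
          rw [hcc] at h1
          rw [hr's _ hz]
          linarith [hr'0 v, hr v]
      · refine hra.trans (SimpleGraph.Adj.reachable ⟨fun h => hv (h ▸ ha.1), ?_⟩)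
        -- An unselected component is light. Its diameter bound `2 * S ≤ 2 * tot / m` puts the
        -- centre of `v` inside the enlarged disk of `a`.
        have hlight : m * S (c v) ≤ tot := by
          by_contra! hh
          exact hz (Finset.mem_union_right _
            (Finset.mem_filter.2 ⟨Finset.mem_univ _, hcA v hv, hcc v, hh⟩))
        obtain ⟨haA, u, hu, hcu, hau⟩ := ha
        have huH : H (c v) u := hcu ▸ H.symm (hcH u)
        have hvH : H u v := H.trans (H.symm huH) (H.symm (hcH v))
        have hSu : S u = S (c v) := by
          simp only [hSdef]
          refine Finset.sum_congr (Finset.filter_congr fun i _ => ?_) fun _ _ => rfl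
          exact ⟨fun h => H.trans huH h, fun h => H.trans (H.symm huH) h⟩
        have h1 := hdiam u v hvH
        have h2 := hau.2
        have h3 := dist_triangle (P a) (P u) (P v)
        have h4 : 2 * S (c v) ≤ 2 * tot / m := by
          rw [le_div_iff₀ hm]; linarith
        rw [hr'A a haA]
        change dist (P u) (P v) + r u + r v ≤ 2 * S u at h1
        linarith [hr'0 v, hr v]
    have : Nonempty (Fin n) := ⟨a₀⟩
    exact ⟨fun u v => (hall u).symm.trans (hall v)⟩
  · have hsub : (Finset.univ.filter fun i => r' i ≠ 0) ⊆ A ∪ sel := by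
      intro v hv
      by_contra hcon
      rw [Finset.mem_union, not_or] at hcon
      exact (Finset.mem_filter.1 hv).2 (hr'n v hcon.1 hcon.2)
    refine (Finset.card_le_card hsub).trans ((Finset.card_union_le _ _).trans ?_)
    have : A.card ^ 2 ≤ sparseBound q q ^ 2 := Nat.pow_le_pow_left hAcard 2
    have : 2 * q * A.card ≤ 2 * q * sparseBound q q := Nat.mul_le_mul_left _ hAcard
    simp only [sparseBound]
    omega
  · have hsplit : ∑ v, r' v = ∑ v ∈ A, (r v + 2 * tot / m) + ∑ v ∈ sel, (S v + r v) := by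
      rw [← Finset.sum_congr rfl hr'A, ← Finset.sum_congr rfl hr's,
        ← Finset.sum_union hselA.symm]
      refine (Finset.sum_subset (Finset.subset_univ _) fun v _ hv => ?_).symm
      rw [Finset.mem_union, not_or] at hv
      exact hr'n v hv.1 hv.2
    -- The selected components are disjoint from each other and from `A`, so their weights are paid
    -- for by the old solution. The surcharges are the enlargement of `A` and the radii of the
    -- chosen centres, the latter bounded by `hselsum`.
    have hdisj : ∑ v ∈ A, r v + ∑ v ∈ sel, S v ≤ tot := by
      have hd : (sel : Set (Fin n)).PairwiseDisjoint
          fun v => Finset.univ.filter fun i => H v i := by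
        intro u hu v hv huv
        rw [Function.onFun, Finset.disjoint_left]
        intro i hi hi'
        simp only [Finset.mem_filter, Finset.mem_univ, true_and] at hi hi'
        exact huv (by rw [← (hsel u hu).2, ← (hsel v hv).2, hc u i hi, hc v i hi'])
      rw [hSdef, ← Finset.sum_biUnion hd, ← Finset.sum_union]
      · exact Finset.sum_le_sum_of_subset_of_nonneg (Finset.subset_univ _) fun i _ _ => hr i
      · rw [Finset.disjoint_left]
        intro i hi hi'
        obtain ⟨v, hv, hiv⟩ := Finset.mem_biUnion.1 hi'
        simp only [Finset.mem_filter, Finset.mem_univ, true_and] at hiv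
        exact hHA v i hiv (hsel v hv).1 hi
    have hextra : ∑ _v ∈ A, 2 * tot / (m : ℝ) = tot / q := by
      have : (A.card : ℝ) ≠ 0 := by exact_mod_cast hApos.ne'
      rw [Finset.sum_const, nsmul_eq_mul]
      rw [hmdef]; push_cast
      field_simp
    rw [hsplit, Finset.sum_add_distrib, Finset.sum_add_distrib, hextra]
    have : (1 + 2 / (q : ℝ)) * tot = tot + tot / q + tot / q := by ring
    linarith

end Sparse

/-! ### Rounding the radii to multiples of a unit -/

section Discrete

variable {n : ℕ} {P : Fin n → EuclideanSpace ℝ (Fin 2)} {r : Fin n → ℝ}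

theorem IsFeasible.mono (h : IsFeasible P r) {r' : Fin n → ℝ} (hr : ∀ i, r i ≤ r' i) :
    IsFeasible P r' :=
  ⟨fun i => (h.1 i).trans (hr i),
    h.2.mono fun i j (hij : (connectivityGraph P r).Adj i j) =>
      ⟨hij.1, hij.2.trans (add_le_add (hr i) (hr j))⟩⟩

/-- Any two centres are joined by a walk of intersecting disks. Its use is the lower bound on the
optimum against which rounding errors are measured. -/
theorem IsFeasible.dist_le (h : IsFeasible P r) (i j : Fin n) :
    dist (P i) (P j) ≤ 2 * ∑ i, r i := by
  have hg : (connectivityGraph P r).Grown Finset.univ :=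
    SimpleGraph.Grown.of_reachable (c := i) (by simp) fun v => by
      simpa using h.2.preconnected i v
  have := hg.le_sum (D := fun u v => (dist (P u) (P v) + r u + r v) / 2) h.1
    (fun u v => by simp only [dist_comm]; ring) (fun v => by simp)
    (fun u v w huv => by
      have := dist_triangle (P w) (P u) (P v)
      have := huv.2
      linarith) i (by simp) j (by simp)
  linarith [h.1 i, h.1 j]

theorem isFeasible_single (i₀ : Fin n) {ρ : ℝ} (hρ : 0 ≤ ρ) (h : ∀ i, dist (P i₀) (P i) ≤ ρ) :
    IsFeasible P (Pi.single i₀ ρ) := by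
  refine ⟨fun i => ?_, ?_⟩
  · by_cases hi : i = i₀
    · subst hi; simpa
    · simp [hi]
  · have key : ∀ i, (connectivityGraph P (Pi.single i₀ ρ)).Reachable i₀ i := fun i => by
      by_cases hi : i = i₀
      · rw [hi]
      · exact SimpleGraph.Adj.reachable ⟨Ne.symm hi, by simpa [hi] using h i⟩
    have : Nonempty (Fin n) := ⟨i₀⟩
    exact ⟨fun i j => (key i).symm.trans (key j)⟩

/-- `M` is the radius of the point set around `P i₀` in the maximum norm, up to a constant. -/
structure IsExtent (P : Fin n → EuclideanSpace ℝ (Fin 2)) (i₀ : Fin n) (M : ℝ) : Prop where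
  abs_le : ∀ i k, |P i k - P i₀ k| ≤ M
  le_dist : ∃ i, M ≤ dist (P i₀) (P i)

theorem IsExtent.nonneg {i₀ : Fin n} {M : ℝ} (h : IsExtent P i₀ M) : 0 ≤ M :=
  (abs_nonneg _).trans (h.abs_le i₀ 0)

theorem dist_sq_eq (p p' : EuclideanSpace ℝ (Fin 2)) :
    dist p p' ^ 2 = (p 0 - p' 0) ^ 2 + (p 1 - p' 1) ^ 2 := by
  rw [EuclideanSpace.dist_eq, Real.sq_sqrt (by positivity)]
  simp [Real.dist_eq, sq_abs]

theorem IsExtent.dist_le {i₀ : Fin n} {M : ℝ} (h : IsExtent P i₀ M) (i : Fin n) :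
    dist (P i₀) (P i) ≤ 2 * M := by
  refine abs_le_of_sq_le_sq' ?_ (by linarith [h.nonneg]) |>.2
  rw [dist_comm, dist_sq_eq]
  have h0 := sq_le_sq' (_root_.abs_le.1 (h.abs_le i 0)).1 (_root_.abs_le.1 (h.abs_le i 0)).2
  have h1 := sq_le_sq' (_root_.abs_le.1 (h.abs_le i 1)).1 (_root_.abs_le.1 (h.abs_le i 1)).2
  nlinarith [sq_nonneg M]

theorem IsExtent.le_sum {i₀ : Fin n} {M : ℝ} (h : IsExtent P i₀ M) (hr : IsFeasible P r) :
    M ≤ 2 * ∑ i, r i := by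
  obtain ⟨i, hi⟩ := h.le_dist
  exact hi.trans (hr.dist_le i₀ i)

/-- The number of units into which the extent is divided. -/
def gridSize (q : ℕ) : ℕ := q * sparseBound q (q + 1)

theorem gridSize_pos {q : ℕ} (hq : 0 < q) : 0 < gridSize q :=
  Nat.mul_pos hq (sparseBound_pos _ _)

/-- One disk of radius `2 * M` around `P i₀` contains all centres. The number of units is
independent of `n`, which bounds the length of the search by a polynomial. -/
theorem IsExtent.exists_grid_feasible {i₀ : Fin n} {M : ℝ} (h : IsExtent P i₀ M) {q : ℕ}
    (hq : 0 < q) : ∃ a : Fin n → ℕ, ∑ i, a i = 2 * gridSize q ∧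
      IsFeasible P fun i => M / gridSize q * a i := by
  have hx : (gridSize q : ℝ) ≠ 0 := by exact_mod_cast (gridSize_pos hq).ne'
  refine ⟨Pi.single i₀ (2 * gridSize q), by simp, ?_⟩
  convert isFeasible_single (P := P) i₀ (ρ := 2 * M) (by linarith [h.nonneg]) h.dist_le using 2
    with i
  by_cases hi : i = i₀
  · subst hi; simp; field_simp
  · simp [hi]

/-- Rounding up costs at most one unit per nonzero radius of a sparse solution, hence at most `M /
q` by the choice of `gridSize`, and `M` is at most twice the cost of any solution. -/
theorem IsExtent.exists_grid_approx {i₀ : Fin n} {M : ℝ} (h : IsExtent P i₀ M) {q : ℕ}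
    (hq : 0 < q) (hr : IsFeasible P r) :
    ∃ a : Fin n → ℕ, (IsFeasible P fun i => M / gridSize q * a i) ∧
      ∑ i, M / gridSize q * a i ≤ (1 + 4 / q) * ∑ i, r i := by
  have hq' : (0 : ℝ) < q := by exact_mod_cast hq
  have hx : (0 : ℝ) < gridSize q := by exact_mod_cast gridSize_pos hq
  have hr0 : 0 ≤ ∑ i, r i := Finset.sum_nonneg fun i _ => hr.1 i
  -- For `M = 0` the unit is zero and cannot be divided by; the grid solution then costs nothing.
  rcases h.nonneg.eq_or_lt with hM | hM
  · obtain ⟨a, -, ha⟩ := h.exists_grid_feasible hq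
    refine ⟨a, ha, ?_⟩
    simp only [← hM, zero_div, zero_mul, Finset.sum_const_zero]
    positivity
  obtain ⟨r', hr', hcard, hsum⟩ := hr.exists_sparse hq
  have hμ : 0 < M / gridSize q := div_pos hM hx
  set μ := M / gridSize q with hμdef
  refine ⟨fun i => ⌈r' i / μ⌉₊, hr'.mono fun i => ?_, ?_⟩
  · rw [← div_le_iff₀' hμ]
    exact Nat.le_ceil _
  · have hle : ∀ i, μ * (⌈r' i / μ⌉₊ : ℝ) ≤ r' i + if r' i ≠ 0 then μ else 0 := by
      intro i
      split_ifs with hi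
      · have := (Nat.ceil_lt_add_one (div_nonneg (hr'.1 i) hμ.le)).le
        calc μ * (⌈r' i / μ⌉₊ : ℝ) ≤ μ * (r' i / μ + 1) := by gcongr
          _ = r' i + μ := by field_simp
      · rw [not_not] at hi
        simp [hi]
    have h1 := Finset.sum_le_sum fun i (_ : i ∈ Finset.univ) => hle i
    rw [Finset.sum_add_distrib, ← Finset.sum_filter, Finset.sum_const, nsmul_eq_mul] at h1
    have h2 : ((Finset.univ.filter fun i => r' i ≠ 0).card : ℝ) * μ ≤ M / q := by
      calc _ ≤ (sparseBound q (q + 1) : ℝ) * μ := by gcongr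
        _ = M / q := by
          have : (sparseBound q (q + 1) : ℝ) ≠ 0 := by exact_mod_cast (sparseBound_pos _ _).ne'
          rw [hμdef, gridSize]; push_cast; field_simp
    have h3 : M / q ≤ 2 / q * ∑ i, r i := by
      rw [div_mul_eq_mul_div]; gcongr; exact h.le_sum hr
    have h4 : (1 + 4 / (q : ℝ)) * ∑ i, r i = (1 + 2 / q) * ∑ i, r i + 2 / q * ∑ i, r i := by ring
    linarith

end Discrete

/-! ### Enumerating vectors of multiplicities by numerals -/

section Digits

/-- The multiplicity of the digit `i` in the bijective base-`n` numeral of `t`, with the digits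
`0, …, n - 1`. -/
def digitCount (n : ℕ) : ℕ → ℕ → ℕ
  | 0, _ => 0
  | t + 1, i => digitCount n (t / n) i + if t % n = i then 1 else 0
decreasing_by exact Nat.lt_succ_of_le (Nat.div_le_self _ _)

/-- The length of the bijective base-`n` numeral of `t`. -/
def digitLength (n : ℕ) : ℕ → ℕ
  | 0 => 0
  | t + 1 => digitLength n (t / n) + 1
decreasing_by exact Nat.lt_succ_of_le (Nat.div_le_self _ _)

variable {n : ℕ}

theorem sum_digitCount (hn : 0 < n) (t : ℕ) :
    ∑ i : Fin n, digitCount n t i = digitLength n t := by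
  induction t using Nat.strong_induction_on with
  | _ t ih =>
    cases t with
    | zero => simp [digitCount, digitLength]
    | succ t =>
      simp only [digitCount, digitLength, Finset.sum_add_distrib]
      rw [ih _ (Nat.lt_succ_of_le (Nat.div_le_self _ _))]
      have : ∀ i : Fin n, (t % n = i) ↔ (⟨t % n, Nat.mod_lt _ hn⟩ = i) := fun i => by
        rw [Fin.ext_iff]
      simp only [this, Finset.sum_ite_eq, Finset.mem_univ, if_true]

/-- This is why the search may stop at the first success: later numerals never use fewer units. -/
theorem digitLength_mono (n : ℕ) : Monotone (digitLength n) := by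
  intro s t
  induction t using Nat.strong_induction_on generalizing s with
  | _ t ih =>
    intro hst
    cases s with
    | zero => simp [digitLength]
    | succ s =>
      cases t with
      | zero => omega
      | succ t =>
        simp only [digitLength]
        exact Nat.succ_le_succ (ih _ (Nat.lt_succ_of_le (Nat.div_le_self _ _))
          (Nat.div_le_div_right (by omega)))

theorem exists_digitCount_eq (hn : 0 < n) (l : ℕ) :
    ∀ a : Fin n → ℕ, ∑ i, a i = l →
      ∃ t, t + 1 ≤ (n + 1) ^ l ∧ ∀ i : Fin n, digitCount n t i = a i := by
  induction l with
  | zero =>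
    intro a ha
    have : ∀ i, a i = 0 := by simpa using ha
    exact ⟨0, by simp, fun i => by simp [digitCount, this]⟩
  | succ l ih =>
    intro a ha
    obtain ⟨i₀, -, hi₀⟩ : ∃ i ∈ Finset.univ, a i ≠ 0 :=
      Finset.exists_ne_zero_of_sum_ne_zero (by omega)
    have hsplit : ∀ i, a i = Function.update a i₀ (a i₀ - 1) i + if (i₀ : ℕ) = i then 1 else 0 := by
      intro i
      by_cases h : i₀ = i
      · subst h; simp; omega
      · have : (i₀ : ℕ) ≠ i := fun h' => h (Fin.ext h')
        simp [Function.update_of_ne (Ne.symm h), this]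
    obtain ⟨t, ht, hta⟩ := ih (Function.update a i₀ (a i₀ - 1)) (by
      rw [Finset.sum_congr rfl fun i _ => hsplit i, Finset.sum_add_distrib] at ha
      simp only [← Fin.ext_iff, Finset.sum_ite_eq, Finset.mem_univ, if_true] at ha
      omega)
    -- The numeral of `t` with the digit `i₀` appended; the final `+ 1` is the shift of the
    -- bijective numeration.
    refine ⟨n * t + i₀ + 1, ?_, fun i => ?_⟩
    · have h1 : n * (t + 1) ≤ n * (n + 1) ^ l := Nat.mul_le_mul_left n ht
      have h2 := Nat.one_le_pow l (n + 1) (by omega)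
      have := i₀.2
      rw [pow_succ, mul_add, mul_one, mul_comm _ n]
      rw [mul_add] at h1
      omega
    · have h1 : (n * t + i₀) / n = t := by
        rw [Nat.mul_add_div hn, Nat.div_eq_of_lt i₀.2, add_zero]
      have h2 : (n * t + i₀) % n = i₀ := by
        rw [Nat.mul_add_mod, Nat.mod_eq_of_lt i₀.2]
      rw [digitCount, h1, h2, hta, ← hsplit]

end Digits

/-! ### Reasoning about programs -/

namespace RealRAM

/-- The program halts from `s` within `b` steps in a state that satisfies `Q`. -/
def Runs (p : Prog) (s : State) (b : ℕ) (Q : State → Prop) : Prop :=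
  ∃ s' k, Exec p s s' k ∧ k ≤ b ∧ Q s'

namespace Runs

variable {p p' : Prog} {s : State} {b c : ℕ} {Q R : State → Prop} {t : Test}

theorem mono (h : Runs p s b Q) (hb : b ≤ c) (hQ : ∀ s', Q s' → R s') : Runs p s c R := by
  obtain ⟨s', k, hk, hkb, hs⟩ := h
  exact ⟨s', k, hk, hkb.trans hb, hQ s' hs⟩

theorem skip (h : Q s) : Runs .skip s 1 Q := ⟨s, 1, .skip s, le_rfl, h⟩

theorem instr {i : Instr} (h : Q (i.apply s)) : Runs (.instr i) s 1 Q :=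
  ⟨_, 1, .instr i s, le_rfl, h⟩

theorem seq (h : Runs p s b fun s' => Runs p' s' c Q) : Runs (.seq p p') s (b + c) Q := by
  obtain ⟨s', k, hk, hkb, s'', l, hl, hlc, hs⟩ := h
  exact ⟨s'', k + l, hk.seq hl, Nat.add_le_add hkb hlc, hs⟩

theorem cond (h₁ : t.Holds s → Runs p s b Q) (h₂ : ¬ t.Holds s → Runs p' s b Q) :
    Runs (.cond t p p') s (b + 1) Q := by
  by_cases ht : t.Holds s
  · obtain ⟨s', k, hk, hkb, hs⟩ := h₁ ht
    exact ⟨s', k + 1, .cond_true ht hk, Nat.succ_le_succ hkb, hs⟩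
  · obtain ⟨s', k, hk, hkb, hs⟩ := h₂ ht
    exact ⟨s', k + 1, .cond_false ht hk, Nat.succ_le_succ hkb, hs⟩

/-- A loop with at most `N` rounds of at most `b` steps, where `I j` holds after `j` rounds. -/
theorem loop (I : ℕ → State → Prop) (N : ℕ) (h0 : I 0 s)
    (hstep : ∀ j s', I j s' → t.Holds s' → j < N ∧ Runs p s' b (I (j + 1)))
    (hQ : ∀ j s', I j s' → ¬ t.Holds s' → Q s') : Runs (.loop t p) s (N * (b + 1) + 1) Q := by
  have key : ∀ m j s', j + m = N → I j s' → Runs (.loop t p) s' (m * (b + 1) + 1) Q := by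
    intro m
    induction m with
    | zero =>
      intro j s' hj hI
      by_cases ht : t.Holds s'
      · exact absurd (hstep j s' hI ht).1 (by omega)
      · exact ⟨s', 1, .loop_done ht, by omega, hQ j s' hI ht⟩
    | succ m ih =>
      intro j s' hj hI
      by_cases ht : t.Holds s'
      · obtain ⟨s₁, k, hk, hkb, h₁⟩ := (hstep j s' hI ht).2
        obtain ⟨s₂, l, hl, hlb, h₂⟩ := ih (j + 1) s₁ (by omega) h₁
        exact ⟨s₂, k + l + 1, .loop_step ht hk hl, by rw [Nat.succ_mul]; omega, h₂⟩
      · exact ⟨s', 1, .loop_done ht, by omega, hQ j s' hI ht⟩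
  exact key N 0 s (by omega) h0

end Runs

/-- A sequence of instructions. -/
def block : List Instr → Prog
  | [] => .skip
  | i :: l => .seq (.instr i) (block l)

theorem Runs.block {l : List Instr} {s : State} {Q : State → Prop}
    (h : Q (l.foldl (fun s i => i.apply s) s)) : Runs (block l) s (l.length + 1) Q := by
  induction l generalizing s with
  | nil => exact .skip h
  | cons i l ih =>
    rw [List.length_cons, add_right_comm, add_comm]
    exact .seq (.instr (ih h))

/-- `forDown a p` runs `p` with the values `n - 1, …, 0` of the index register `a`, where `n` is
the content of the index register `0` and the index register `1` holds `1`. -/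
def forDown (a : ℕ) (p : Prog) : Prog :=
  .seq (.instr (.imove a 0)) (.loop (.ile 1 a) (.seq (.instr (.isub a a 1)) p))

/-- `I i` describes the state in which the values `n - 1, …, i` have been treated. Each round has
two steps besides the body, the test and the decrement. -/
theorem Runs.forDown {a : ℕ} {p : Prog} {s : State} {b n : ℕ} {Q : State → Prop}
    (I : ℕ → State → Prop)
    (hI : ∀ i s', I i s' → s'.idx a = i ∧ s'.idx 1 = 1)
    (h0 : I n ((Instr.imove a 0).apply s))
    (hstep : ∀ i s', i < n → I (i + 1) s' → Runs p ((Instr.isub a a 1).apply s') b (I i))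
    (hQ : ∀ s', I 0 s' → Q s') : Runs (forDown a p) s (n * (b + 2) + 2) Q := by
  have : n * (b + 2) + 2 = 1 + (n * (1 + b + 1) + 1) := by ring
  rw [this]
  refine .seq (.instr (.loop (fun j s' => j ≤ n ∧ I (n - j) s') n ⟨Nat.zero_le _, h0⟩ ?_ ?_))
  · rintro j s' ⟨hj, hIj⟩ ht
    obtain ⟨h1, h2⟩ := hI _ _ hIj
    simp only [Test.Holds, h1, h2] at ht
    refine ⟨by omega, .seq (.instr ?_)⟩
    refine (hstep (n - (j + 1)) s' (by omega) ?_).mono le_rfl fun s'' h => ⟨by omega, h⟩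
    rwa [show n - (j + 1) + 1 = n - j by omega]
  · rintro j s' ⟨hj, hIj⟩ ht
    obtain ⟨h1, h2⟩ := hI _ _ hIj
    simp only [Test.Holds, h1, h2] at ht
    have : n - j = 0 := by omega
    exact hQ s' (this ▸ hIj)

/-! ### The program -/

open Instr Test Prog

/-- The content of the registers that are constant in the search: the number of points, the
constants `1` and `0`, the address of the radii, the unit of length, and the real `0`. -/
def Const (n : ℕ) (μ : ℝ) (s : State) : Prop :=
  s.idx 0 = n ∧ s.idx 1 = 1 ∧ s.idx 4 = 0 ∧ s.idx 5 = 2 * n ∧ s.reg 1 = μ ∧ s.reg 2 = 0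

/-- Set all radii to zero. -/
def clearRadii : Prog := forDown 6 (block [iadd 7 5 6, rstore 7 2])

theorem runs_clearRadii {n : ℕ} {μ : ℝ} {s : State} (hs : Const n μ s) :
    Runs clearRadii s (n * 5 + 2) fun s' => Const n μ s' ∧ s'.idx 2 = s.idx 2 ∧
      (∀ x < 2 * n, s'.rmem x = s.rmem x) ∧ ∀ i < n, s'.rmem (2 * n + i) = 0 := by
  refine .forDown (fun j s' => s'.idx 6 = j ∧ Const n μ s' ∧ s'.idx 2 = s.idx 2 ∧
      (∀ x < 2 * n, s'.rmem x = s.rmem x) ∧ ∀ i < n, j ≤ i → s'.rmem (2 * n + i) = 0)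
      (fun i s' h => ⟨h.1, h.2.1.2.1⟩) ?_ ?_ ?_
  · simp only [Const] at hs
    refine ⟨by simp [Instr.apply, hs], by simp [Const, Instr.apply, hs], by simp [Instr.apply],
      by simp [Instr.apply], fun i h h' => by omega⟩
  · rintro i s' hi ⟨h6, hc, h2, hx, hz⟩
    simp only [Const] at hc
    refine .block ⟨by simp [Instr.apply, hc, h6], by simp [Const, Instr.apply, hc],
      by simp [Instr.apply, h2], fun x hx' => ?_, fun k hk hik => ?_⟩
    · have : x ≠ 2 * n + i := by omega
      simp [Instr.apply, hc, h6, this, hx x hx']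
    · by_cases hki : k = i
      · simp [Instr.apply, hc, h6, hki]
      · simp [Instr.apply, hc, h6, hki, hz k hk (by omega)]
  · rintro s' ⟨-, hc, h2, hx, hz⟩
    exact ⟨hc, h2, hx, fun i hi => hz i hi (Nat.zero_le _)⟩

/-- Divide the content of index register `8` by the number of points. -/
def divide : Prog := .seq (.instr (iconst 9 0)) (.loop (ile 0 8) (block [isub 8 8 0, iadd 9 9 1]))

/-- Index registers cannot be divided, so `n` is subtracted repeatedly; the invariant is remainder
plus `n` times quotient. -/
theorem runs_divide {n : ℕ} (hn : 0 < n) {μ : ℝ} {s : State} (hs : Const n μ s) {w t : ℕ}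
    (hw : s.idx 8 = w) (hwt : w ≤ t) :
    Runs divide s (t * 4 + 2) fun s' => Const n μ s' ∧ s'.idx 2 = s.idx 2 ∧ s'.rmem = s.rmem ∧
      s'.idx 8 = w % n ∧ s'.idx 9 = w / n := by
  rw [show t * 4 + 2 = 1 + (t * (3 + 1) + 1) by ring]
  refine .seq (.instr (.loop (fun j s' => Const n μ s' ∧ s'.idx 2 = s.idx 2 ∧ s'.rmem = s.rmem ∧
    s'.idx 8 + n * j = w ∧ s'.idx 9 = j) t ?_ ?_ ?_))
  · simp only [Const] at hs ⊢
    simp [Instr.apply, hs, hw]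
  · rintro j s' ⟨hc, h2, hr, h8, h9⟩ ht
    simp only [Const] at hc
    simp only [Holds, hc] at ht
    have : j ≤ n * j := Nat.le_mul_of_pos_left j hn
    refine ⟨by omega, .block ?_⟩
    simp only [Const, List.foldl, Instr.apply]
    simp [hc, h2, hr, h9]
    rw [mul_add]; omega
  · rintro j s' ⟨hc, h2, hr, h8, h9⟩ ht
    simp only [Holds, hc.1, not_le] at ht
    refine ⟨hc, h2, hr, ?_, ?_⟩
    · rw [← h8, Nat.add_mul_mod_self_left, Nat.mod_eq_of_lt ht]
    · rw [← h8, Nat.add_mul_div_left _ _ hn, Nat.div_eq_of_lt ht, h9, zero_add]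

/-- Add one unit to the radii for every digit of the counter in index register `2`. -/
def addDigits : Prog :=
  .seq (.instr (imove 8 2)) (.loop (ile 1 8) (.seq (.instr (isub 8 8 1)) (.seq divide
    (block [iadd 7 5 8, rload 3 7, radd 3 3 1, rstore 7 3, imove 8 9]))))

theorem runs_addDigits {n : ℕ} (hn : 0 < n) {μ : ℝ} {s : State} (hs : Const n μ s) {t T : ℕ}
    (ht : s.idx 2 = t) (hT : t ≤ T) (hr : ∀ i < n, s.rmem (2 * n + i) = 0) :
    Runs addDigits s (T * (T * 4 + 10) + 2) fun s' => Const n μ s' ∧ s'.idx 2 = t ∧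
      (∀ x < 2 * n, s'.rmem x = s.rmem x) ∧
      ∀ i < n, s'.rmem (2 * n + i) = μ * digitCount n t i := by
  rw [show T * (T * 4 + 10) + 2 = 1 + (T * ((1 + ((T * 4 + 2) + 6)) + 1) + 1) by ring]
  -- Invariant: the units stored so far together with the digits still to be read make up the
  -- numeral of `t`. Each round lowers the rest by at least one.
  refine .seq (.instr (.loop (fun j s' => Const n μ s' ∧ s'.idx 2 = t ∧
    (∀ x < 2 * n, s'.rmem x = s.rmem x) ∧ s'.idx 8 + j ≤ T ∧
    ∀ i < n, s'.rmem (2 * n + i) + μ * digitCount n (s'.idx 8) i = μ * digitCount n t i) T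
    ?_ ?_ ?_))
  · simp only [Const] at hs ⊢
    simp [Instr.apply, hs, ht, hT]
    exact hr
  · rintro j s' ⟨hc, h2, hx, hj, hd⟩ hpos
    simp only [Const] at hc
    simp only [Holds, hc] at hpos
    obtain ⟨w, hw⟩ : ∃ w, s'.idx 8 = w + 1 := ⟨s'.idx 8 - 1, by omega⟩
    refine ⟨by omega, .seq (.instr (.seq ((runs_divide hn (w := w) (t := T) (μ := μ) ?_ ?_
      (by omega)).mono le_rfl ?_)))⟩
    · simp [Const, Instr.apply, hc]
    · simp [Instr.apply, hw, hc]
    · rintro s'' ⟨hc'', h2'', hr'', h8, h9⟩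
      have h2t : s''.idx 2 = t := by rw [h2'']; simpa [Instr.apply] using h2
      have hr3 : s''.rmem = s'.rmem := by rw [hr'']; simp [Instr.apply]
      simp only [Const] at hc''
      refine .block ⟨?_, ?_, ?_, ?_, ?_⟩
      · simp [Const, Instr.apply, hc'']
      · simp [Instr.apply, h2t]
      · intro x hx'
        have : x ≠ 2 * n + w % n := by omega
        simp [Instr.apply, hc'', h8, this, hr3, hx x hx']
      · have := Nat.div_le_self w n
        simp [Instr.apply, h9]
        omega
      · intro i hi
        have h := hd i hi
        rw [hw, digitCount] at h
        by_cases hiw : i = w % n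
        · simp [Instr.apply, hc'', h8, h9, hr3, hiw]
          rw [← hiw]
          simp [hiw] at h
          rw [← hiw] at h
          linarith
        · have : 2 * n + i ≠ 2 * n + w % n := by omega
          simp [Instr.apply, hc'', h8, h9, hr3, hiw]
          simpa [Ne.symm hiw] using h
  · rintro j s' ⟨hc, h2, hx, hj, hd⟩ hpos
    have hc' := hc
    simp only [Const] at hc
    simp only [Holds, hc] at hpos
    have h8 : s'.idx 8 = 0 := by omega
    refine ⟨hc', h2, hx, fun i hi => ?_⟩
    simpa [h8, digitCount] using hd i hi

/-! ### The connectivity test -/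

/-- Adjacency of two disks, in terms of the real memory. -/
def MemAdj (n : ℕ) (m : ℕ → ℝ) (u v : ℕ) : Prop :=
  (m (2 * u) - m (2 * v)) * (m (2 * u) - m (2 * v)) +
    (m (2 * u + 1) - m (2 * v + 1)) * (m (2 * u + 1) - m (2 * v + 1)) ≤
  (m (2 * n + u) + m (2 * n + v)) * (m (2 * n + u) + m (2 * n + v))

/-- `Level n m j v`: the disk `v` is at most `j` steps away from the disk `0`. -/
def Level (n : ℕ) (m : ℕ → ℝ) : ℕ → ℕ → Prop
  | 0, v => v = 0
  | j + 1, v => Level n m j v ∨ ∃ u < n, Level n m j u ∧ MemAdj n m u v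

/-- Mark the disk in index register `8` if it is adjacent to the disk in index register `7`. -/
def markIfAdj : Prog :=
  .seq (block [iadd 9 7 7, iadd 10 8 8, rload 3 9, rload 4 10, rsub 3 3 4, rmul 3 3 3,
    iadd 9 9 1, iadd 10 10 1, rload 4 9, rload 5 10, rsub 4 4 5, rmul 4 4 4, radd 3 3 4,
    iadd 9 5 7, iadd 10 5 8, rload 4 9, rload 5 10, radd 4 4 5, rmul 4 4 4])
  (.cond (rle 3 4) (.instr (istore 8 1)) .skip)

/-- The part of the state that the connectivity test preserves: the constants, the counter, and
the real memory. -/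
def Fixed (n : ℕ) (μ : ℝ) (t : ℕ) (m : ℕ → ℝ) (s : State) : Prop :=
  Const n μ s ∧ s.idx 2 = t ∧ s.rmem = m

variable {n : ℕ} {μ : ℝ} {t : ℕ} {m : ℕ → ℝ} {s : State}

theorem runs_markIfAdj {u v : ℕ} (hs : Fixed n μ t m s) (hu : s.idx 7 = u) (hv : s.idx 8 = v) :
    Runs markIfAdj s 22 fun s' => Fixed n μ t m s' ∧ s'.idx 6 = s.idx 6 ∧ s'.idx 7 = u ∧
      s'.idx 8 = v ∧ (MemAdj n m u v → 1 ≤ s'.imem v) ∧ (∀ x, 1 ≤ s.imem x → 1 ≤ s'.imem x) ∧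
      ∀ x, 1 ≤ s'.imem x → 1 ≤ s.imem x ∨ (x = v ∧ MemAdj n m u v) := by
  simp only [Fixed, Const] at hs
  obtain ⟨⟨h0, h1, h4, h5, hr1, hr2⟩, h2, rfl⟩ := hs
  rw [show 22 = 20 + (1 + 1) by rfl]
  refine .seq (.block (.cond (fun h => .instr ?_) fun h => .skip ?_))
  · have hadj : MemAdj n s.rmem u v := by
      simpa [Holds, MemAdj, Instr.apply, h5, h1, hu, hv, two_mul] using h
    refine ⟨by simp [Fixed, Const, Instr.apply, *], by simp [Instr.apply], by simp [Instr.apply, *],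
      by simp [Instr.apply, *], by simp [Instr.apply, *], fun x hx => ?_, fun x hx => ?_⟩
    · by_cases hxv : x = v
      · simp [Instr.apply, *]
      · simpa [Instr.apply, hv, hxv] using hx
    · by_cases hxv : x = v
      · exact .inr ⟨hxv, hadj⟩
      · left; simpa [Instr.apply, hv, hxv] using hx
  · have hadj : ¬ MemAdj n s.rmem u v := by
      simpa [Holds, MemAdj, Instr.apply, h5, h1, hu, hv, two_mul] using h
    refine ⟨by simp [Fixed, Const, Instr.apply, *], by simp [Instr.apply], by simp [Instr.apply, *],
      by simp [Instr.apply, *], fun h => absurd h hadj, fun x hx => ?_, fun x hx => .inl ?_⟩ <;>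
    simpa [Instr.apply] using hx

/-- All marked disks can be reached from the disk `0`. -/
def Sound (n : ℕ) (m : ℕ → ℝ) (s : State) : Prop :=
  ∀ v < n, 1 ≤ s.imem v → ∃ j, Level n m j v

theorem Level.step {j u v : ℕ} (hu : u < n) (h : Level n m j u) (hadj : MemAdj n m u v) :
    Level n m (j + 1) v := .inr ⟨u, hu, h, hadj⟩

/-- Mark the neighbours of the disk in index register `7`. -/
def markNeighbors : Prog := forDown 8 markIfAdj

theorem runs_markNeighbors {u : ℕ} (hun : u < n) (hs : Fixed n μ t m s) (hu : s.idx 7 = u)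
    (hsound : Sound n m s) (hmark : 1 ≤ s.imem u) :
    Runs markNeighbors s (n * 24 + 2) fun s' => Fixed n μ t m s' ∧ s'.idx 6 = s.idx 6 ∧
      s'.idx 7 = u ∧ Sound n m s' ∧ (∀ x, 1 ≤ s.imem x → 1 ≤ s'.imem x) ∧
      ∀ v < n, MemAdj n m u v → 1 ≤ s'.imem v := by
  refine .forDown (fun i s' => s'.idx 8 = i ∧ Fixed n μ t m s' ∧ s'.idx 6 = s.idx 6 ∧
      s'.idx 7 = u ∧ Sound n m s' ∧ (∀ x, 1 ≤ s.imem x → 1 ≤ s'.imem x) ∧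
      ∀ v < n, i ≤ v → MemAdj n m u v → 1 ≤ s'.imem v)
      (fun i s' h => ⟨h.1, h.2.1.1.2.1⟩) ?_ ?_ ?_
  · simp only [Fixed, Const] at hs
    refine ⟨by simp [Instr.apply, hs], by simp [Fixed, Const, Instr.apply, hs],
      by simp [Instr.apply], by simp [Instr.apply, hu], ?_, by simp [Instr.apply],
      fun v h h' => by omega⟩
    simpa [Sound, Instr.apply] using hsound
  · rintro i s' hi ⟨h8, hf, h6, h7, hS, hmono, hadj⟩
    simp only [Fixed, Const] at hf
    refine (runs_markIfAdj (u := u) (v := i) (n := n) (μ := μ) (t := t) (m := m) ?_ ?_ ?_).mono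
      le_rfl ?_
    · simp [Fixed, Const, Instr.apply, hf]
    · simp [Instr.apply, h7]
    · simp [Instr.apply, h8, hf]
    · rintro s'' ⟨hf'', h6'', h7'', h8'', hi'', hmono'', hinv⟩
      refine ⟨h8'', hf'', ?_, h7'', ?_, ?_, ?_⟩
      · rw [h6'']; simpa [Instr.apply] using h6
      · intro x hxn hx
        rcases hinv x hx with hx | ⟨rfl, hx⟩
        · exact hS x hxn hx
        · obtain ⟨j, hj⟩ := hsound u hun hmark
          exact ⟨j + 1, hj.step hun hx⟩
      · exact fun x hx => hmono'' x (hmono x hx)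
      · intro v hv hiv huv
        by_cases h : v = i
        · subst h; exact hi'' huv
        · exact hmono'' v (hadj v hv (by omega) huv)
  · rintro s' ⟨-, hf, h6, h7, hS, hmono, hadj⟩
    exact ⟨hf, h6, h7, hS, hmono, fun v hv => hadj v hv (Nat.zero_le _)⟩

/-- Mark the neighbours of all marked disks. -/
def markRound : Prog :=
  forDown 7 (.seq (.instr (iload 9 7)) (.cond (ile 1 9) markNeighbors .skip))

/-- Disks marked during a round may pass on their mark in the same round, so the marks are not
exactly a level: they contain level `j + 1` and stay within the reachable disks. -/
theorem runs_markRound {j : ℕ} (hs : Fixed n μ t m s) (hsound : Sound n m s)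
    (hlev : ∀ v < n, Level n m j v → 1 ≤ s.imem v) :
    Runs markRound s (n * (n * 24 + 6) + 2) fun s' => Fixed n μ t m s' ∧ s'.idx 6 = s.idx 6 ∧
      Sound n m s' ∧ ∀ v < n, Level n m (j + 1) v → 1 ≤ s'.imem v := by
  refine .forDown (b := n * 24 + 4) (fun i s' => s'.idx 7 = i ∧ Fixed n μ t m s' ∧
      s'.idx 6 = s.idx 6 ∧ Sound n m s' ∧ (∀ v < n, Level n m j v → 1 ≤ s'.imem v) ∧
      ∀ u < n, i ≤ u → Level n m j u → ∀ v < n, MemAdj n m u v → 1 ≤ s'.imem v)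
      (fun i s' h => ⟨h.1, h.2.1.1.2.1⟩) ?_ ?_ ?_
  · simp only [Fixed, Const] at hs
    refine ⟨by simp [Instr.apply, hs], by simp [Fixed, Const, Instr.apply, hs],
      by simp [Instr.apply], ?_, by simpa [Instr.apply] using hlev, fun v h h' => by omega⟩
    simpa [Sound, Instr.apply] using hsound
  · rintro i s' hi ⟨h7, hf, h6, hS, hlev', hadj⟩
    simp only [Fixed, Const] at hf
    rw [show n * 24 + 4 = 1 + ((n * 24 + 2) + 1) by ring]
    have hSs : ∀ s'' : State, s''.imem = s'.imem → Sound n m s'' := fun s'' h v hvn hv =>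
      hS v hvn (h ▸ hv)
    refine .seq (.instr (.cond (fun hm => ?_) fun hm => .mono (.skip ?_) (by omega) fun _ => id))
    · simp [Holds, Instr.apply, hf, h7] at hm
      refine (runs_markNeighbors (u := i) (n := n) (μ := μ) (t := t) (m := m) hi
        (by simp [Fixed, Const, Instr.apply, hf]) (by simp [Instr.apply, h7, hf])
        (hSs _ (by simp [Instr.apply])) (by simpa [Instr.apply] using hm)).mono le_rfl ?_
      rintro s'' ⟨hf'', h6'', h7'', hS'', hmono, hnew⟩
      simp only [Instr.apply] at hmono
      refine ⟨h7'', hf'', ?_, hS'', fun v hv hl => hmono v (hlev' v hv hl), ?_⟩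
      · rw [h6'']; simpa [Instr.apply] using h6
      · intro u hu hiu hl v hv huv
        by_cases h : u = i
        · subst h; exact hnew v hv huv
        · exact hmono v (hadj u hu (by omega) hl v hv huv)
    · simp [Holds, Instr.apply, hf, h7] at hm
      refine ⟨by simp [Instr.apply, h7, hf], by simp [Fixed, Const, Instr.apply, hf],
        by simp [Instr.apply, h6], hSs _ (by simp [Instr.apply]),
        by simpa [Instr.apply] using hlev',
        fun u hu hiu hl v hv huv => ?_⟩
      by_cases h : u = i
      · subst h
        have := hlev' u hu hl
        omega
      · simpa [Instr.apply] using hadj u hu (by omega) hl v hv huv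
  · rintro s' ⟨-, hf, h6, hS, hlev', hadj⟩
    refine ⟨hf, h6, hS, fun v hv hl => ?_⟩
    rcases hl with hl | ⟨u, hu, hl, huv⟩
    · exact hlev' v hv hl
    · exact hadj u hu (Nat.zero_le _) hl v hv huv

/-- Unmark all disks. -/
def unmark : Prog := forDown 6 (block [istore 6 4])

theorem runs_unmark (hs : Fixed n μ t m s) :
    Runs unmark s (n * 4 + 2) fun s' => Fixed n μ t m s' ∧ ∀ v < n, s'.imem v = 0 := by
  refine .forDown (fun i s' => s'.idx 6 = i ∧ Fixed n μ t m s' ∧ ∀ v < n, i ≤ v → s'.imem v = 0)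
      (fun i s' h => ⟨h.1, h.2.1.1.2.1⟩) ?_ ?_ ?_
  · simp only [Fixed, Const] at hs
    refine ⟨by simp [Instr.apply, hs], by simp [Fixed, Const, Instr.apply, hs],
      fun v h h' => by omega⟩
  · rintro i s' hi ⟨h6, hf, hz⟩
    simp only [Fixed, Const] at hf
    refine .block ⟨by simp [Instr.apply, h6, hf], by simp [Fixed, Const, Instr.apply, hf],
      fun v hvn hv => ?_⟩
    by_cases h : v = i
    · simp [Instr.apply, h6, hf, h]
    · simp [Instr.apply, h6, hf, h]
      exact hz v hvn (by omega)
  · rintro s' ⟨-, hf, hz⟩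
    exact ⟨hf, fun v hv => hz v hv (Nat.zero_le _)⟩

/-- Set index register `3` to `1` if all disks are marked, and to `0` otherwise. -/
def testMarks : Prog :=
  .seq (.instr (iconst 3 1))
    (forDown 6 (.seq (.instr (iload 9 6)) (.cond (ile 1 9) .skip (.instr (iconst 3 0)))))

theorem runs_testMarks (hs : Fixed n μ t m s) :
    Runs testMarks s (n * 5 + 3) fun s' => Fixed n μ t m s' ∧ s'.imem = s.imem ∧
      ((s'.idx 3 = 1 ∧ ∀ v < n, 1 ≤ s.imem v) ∨ (s'.idx 3 = 0 ∧ ¬ ∀ v < n, 1 ≤ s.imem v)) := by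
  rw [show n * 5 + 3 = 1 + (n * (3 + 2) + 2) by ring]
  refine .seq (.instr (.forDown (fun i s' => s'.idx 6 = i ∧ Fixed n μ t m s' ∧
      s'.imem = s.imem ∧ ((s'.idx 3 = 1 ∧ ∀ v < n, i ≤ v → 1 ≤ s.imem v) ∨
      (s'.idx 3 = 0 ∧ ¬ ∀ v < n, 1 ≤ s.imem v)))
      (fun i s' h => ⟨h.1, h.2.1.1.2.1⟩) ?_ ?_ ?_))
  · simp only [Fixed, Const] at hs
    refine ⟨by simp [Instr.apply, hs], by simp [Fixed, Const, Instr.apply, hs],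
      by simp [Instr.apply], .inl ⟨by simp [Instr.apply], fun v h h' => by omega⟩⟩
  · rintro i s' hi ⟨h6, hf, hm, h3⟩
    simp only [Fixed, Const] at hf
    refine .seq (c := 2) (.instr (.cond (fun h => .skip ?_) fun h => .instr ?_))
    · simp [Holds, Instr.apply, hf, h6, hm] at h
      refine ⟨by simp [Instr.apply, h6, hf], by simp [Fixed, Const, Instr.apply, hf],
        by simp [Instr.apply, hm], ?_⟩
      rcases h3 with ⟨h3, hall⟩ | h3
      · refine .inl ⟨by simp [Instr.apply, h3], fun v hv hiv => ?_⟩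
        by_cases hvi : v = i
        · rw [hvi]; omega
        · exact hall v hv (by omega)
      · exact .inr (by simpa [Instr.apply] using h3)
    · simp [Holds, Instr.apply, hf, h6, hm] at h
      refine ⟨by simp [Instr.apply, h6, hf], by simp [Fixed, Const, Instr.apply, hf],
        by simp [Instr.apply, hm], .inr ⟨by simp [Instr.apply], fun hall => ?_⟩⟩
      have := hall i hi
      omega
  · rintro s' ⟨-, hf, hm, h3⟩
    refine ⟨hf, hm, h3.imp (fun h => ⟨h.1, fun v hv => h.2 v hv (Nat.zero_le _)⟩) id⟩

/-- Set index register `3` to `1` if the disks are connected, and to `0` otherwise. -/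
def testConnected : Prog :=
  .seq unmark (.seq (.instr (istore 4 1)) (.seq (forDown 6 markRound) testMarks))

/-- The two outcomes use different level conditions, which is what one-sided control of the marks
yields. They agree for connectivity, because a path has fewer than `n` edges. -/
theorem runs_testConnected (hs : Fixed n μ t m s) :
    Runs testConnected s (n * (n * (n * 24 + 6) + 4) + n * 9 + 8) fun s' => Fixed n μ t m s' ∧
      ((s'.idx 3 = 1 ∧ ∀ v < n, ∃ j, Level n m j v) ∨
        (s'.idx 3 = 0 ∧ ¬ ∀ v < n, Level n m n v)) := by
  rw [show n * (n * (n * 24 + 6) + 4) + n * 9 + 8 =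
    (n * 4 + 2) + (1 + ((n * ((n * (n * 24 + 6) + 2) + 2) + 2) + (n * 5 + 3))) by ring]
  refine .seq ((runs_unmark hs).mono le_rfl ?_)
  rintro s₁ ⟨hf₁, hz⟩
  simp only [Fixed, Const] at hf₁
  refine .seq (.instr (.seq (.forDown (fun i s' => s'.idx 6 = i ∧ i ≤ n ∧ Fixed n μ t m s' ∧
    Sound n m s' ∧ ∀ v < n, Level n m (n - i) v → 1 ≤ s'.imem v)
    (fun i s' h => ⟨h.1, h.2.2.1.1.2.1⟩) ?_ ?_ ?_)))
  · refine ⟨by simp [Instr.apply, hf₁], le_rfl, by simp [Fixed, Const, Instr.apply, hf₁], ?_, ?_⟩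
    · intro v hv h
      by_cases hv0 : v = 0
      · exact ⟨0, hv0⟩
      · simp [Instr.apply, hf₁, hv0, hz v hv] at h
    · intro v hv h
      rw [Nat.sub_self] at h
      simp [Instr.apply, hf₁, show v = 0 from h]
  · rintro i s' hi ⟨h6, -, hf, hS, hlev⟩
    simp only [Fixed, Const] at hf
    refine (runs_markRound (j := n - (i + 1)) (n := n) (μ := μ) (t := t) (m := m)
      (by simp [Fixed, Const, Instr.apply, hf]) (by simpa [Sound, Instr.apply] using hS)
      (by simpa [Instr.apply] using hlev)).mono le_rfl ?_
    rintro s'' ⟨hf'', h6'', hS'', hlev''⟩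
    refine ⟨?_, hi.le, hf'', hS'', ?_⟩
    · rw [h6'']; simp [Instr.apply, h6, hf]
    · rwa [show n - (i + 1) + 1 = n - i by omega] at hlev''
  · rintro s' ⟨-, -, hf, hS, hlev⟩
    refine (runs_testMarks hf).mono le_rfl ?_
    rintro s'' ⟨hf'', -, h3⟩
    refine ⟨hf'', h3.imp (fun h => ⟨h.1, fun v hv => hS v hv (h.2 v hv)⟩) fun h => ⟨h.1, fun h' =>
      h.2 fun v hv => hlev v hv (h' v hv)⟩⟩

/-! ### The exhaustive search -/

/-- Try all values of the counter in index register `2` until the disks are connected. -/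
def search : Prog :=
  .loop (ile 3 4)
    (.seq clearRadii (.seq addDigits (.seq testConnected (.instr (iadd 2 2 1)))))

/-- The memory contents with the points `x` and the radii that belong to the value `t` of the
counter. -/
def trial (n : ℕ) (μ : ℝ) (x : ℕ → ℝ) (t i : ℕ) : ℝ :=
  if i < 2 * n then x i else μ * digitCount n t (i - 2 * n)

theorem memAdj_congr {m m' : ℕ → ℝ} (h : ∀ i < 3 * n, m i = m' i) {u v : ℕ} (hu : u < n)
    (hv : v < n) : MemAdj n m u v ↔ MemAdj n m' u v := by
  simp only [MemAdj]
  rw [h (2 * u) (by omega), h (2 * v) (by omega), h (2 * u + 1) (by omega),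
    h (2 * v + 1) (by omega), h (2 * n + u) (by omega), h (2 * n + v) (by omega)]

theorem level_congr {m m' : ℕ → ℝ} (h : ∀ i < 3 * n, m i = m' i) (j : ℕ) :
    ∀ v < n, Level n m j v ↔ Level n m' j v := by
  induction j with
  | zero => exact fun v _ => Iff.rfl
  | succ j ih =>
    intro v hv
    exact or_congr (ih v hv) (exists_congr fun u => and_congr_right fun hu =>
      and_congr (ih u hu) (memAdj_congr h hu hv))

/-- The search finds the first connected trial. -/
theorem runs_search (hn : 0 < n) {x : ℕ → ℝ} (hs : Const n μ s) (hx : ∀ i < 2 * n, s.rmem i = x i)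
    (h2 : s.idx 2 = 0) (h3 : s.idx 3 = 0) {T : ℕ}
    (hT : ∀ v < n, Level n (trial n μ x T) n v) :
    Runs search s ((T + 1) * (T * (T * 4 + 10) + n * (n * (n * 24 + 6) + 4) + n * 14 + 14) + 1)
      fun s' => ∃ t, (∀ v < n, ∃ j, Level n (trial n μ x t) j v) ∧
        (∀ t', (∀ v < n, Level n (trial n μ x t') n v) → t ≤ t') ∧
        ∀ i < n, s'.rmem (2 * n + i) = μ * digitCount n t i := by
  rw [show T * (T * 4 + 10) + n * (n * (n * 24 + 6) + 4) + n * 14 + 14 =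
    ((n * 5 + 2) + ((T * (T * 4 + 10) + 2) + ((n * (n * (n * 24 + 6) + 4) + n * 9 + 8) + 1))) + 1
    by ring]
  -- The flag in register `3` separates the two states of the loop: all trials before `j` failed, or
  -- the least successful trial is in memory and the loop is about to stop.
  refine .loop (fun j s' => Const n μ s' ∧ (∀ i < 2 * n, s'.rmem i = x i) ∧ s'.idx 2 = j ∧
    ((s'.idx 3 = 0 ∧ ∀ t < j, ¬ ∀ v < n, Level n (trial n μ x t) n v) ∨
      (s'.idx 3 = 1 ∧ ∃ t, (∀ v < n, ∃ j, Level n (trial n μ x t) j v) ∧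
        (∀ t', (∀ v < n, Level n (trial n μ x t') n v) → t ≤ t') ∧
        ∀ i < n, s'.rmem (2 * n + i) = μ * digitCount n t i))) (T + 1) ?_ ?_ ?_
  · exact ⟨hs, hx, h2, .inl ⟨h3, fun t ht => by omega⟩⟩
  · rintro j s' ⟨hc, hx', h2', h3'⟩ hcond
    simp only [Holds, hc.2.2.1] at hcond
    rcases h3' with ⟨-, hno⟩ | ⟨h3', -⟩
    swap
    · omega
    have hj : j ≤ T := by
      by_contra! h
      exact hno T h hT
    refine ⟨by omega, .seq ((runs_clearRadii hc).mono le_rfl ?_)⟩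
    rintro s₁ ⟨hc₁, h2₁, hx₁, hr₁⟩
    refine .seq ((runs_addDigits hn hc₁ (t := j) (by rw [h2₁, h2']) hj hr₁).mono le_rfl ?_)
    rintro s₂ ⟨hc₂, h2₂, hx₂, hr₂⟩
    have hmem : ∀ i < 3 * n, s₂.rmem i = trial n μ x j i := by
      intro i hi
      simp only [trial]
      split_ifs with h
      · rw [hx₂ i h, hx₁ i h, hx' i h]
      · rw [← hr₂ (i - 2 * n) (by omega), Nat.add_sub_cancel' (by omega)]
    refine .seq ((runs_testConnected (t := j) ⟨hc₂, h2₂, rfl⟩).mono le_rfl ?_)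
    rintro s₃ ⟨⟨hc₃, h2₃, hr₃⟩, h3₃⟩
    simp only [Const] at hc₃
    refine .instr ⟨by simp [Const, Instr.apply, hc₃], fun i hi => ?_,
      by simp [Instr.apply, h2₃, hc₃], ?_⟩
    · simp only [Instr.apply, hr₃]
      rw [hx₂ i hi, hx₁ i hi, hx' i hi]
    · rcases h3₃ with ⟨h3₃, hall⟩ | ⟨h3₃, hnot⟩
      · refine .inr ⟨by simp [Instr.apply, h3₃], j, fun v hv => ?_, fun t' ht' => ?_,
          fun i hi => ?_⟩
        · obtain ⟨l, hl⟩ := hall v hv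
          exact ⟨l, (level_congr hmem l v hv).1 hl⟩
        · by_contra! h
          exact hno t' h ht'
        · simp only [Instr.apply, hr₃]
          exact hr₂ i hi
      · refine .inl ⟨by simp [Instr.apply, h3₃], fun t' ht' => ?_⟩
        by_cases h : t' = j
        · subst h
          exact fun hall => hnot fun v hv => (level_congr hmem n v hv).2 (hall v hv)
        · exact hno t' (by omega)
  · rintro j s' ⟨hc, hx', h2', h3'⟩ hcond
    simp only [Holds, hc.2.2.1] at hcond
    rcases h3' with ⟨h3', -⟩ | ⟨-, h⟩
    · omega
    · exact h

/-! ### Initialization: accuracy, grid size and unit of length -/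

variable {ε : ℝ} {x : ℕ → ℝ}

/-- The content of the registers and of the real memory after the initialization. -/
def Start (n : ℕ) (x : ℕ → ℝ) (s : State) : Prop :=
  s.idx 0 = n ∧ s.idx 1 = 1 ∧ s.idx 2 = 0 ∧ s.idx 3 = 0 ∧ s.idx 4 = 0 ∧ s.idx 5 = 2 * n ∧
    s.reg 2 = 0 ∧ s.rmem = x

/-- Find the least positive integer `q` with `4 < q * ε`, as an index in register `6` and as a
real number in register `4`. -/
def findAccuracy : Prog :=
  .seq (block [iconst 1 1, iadd 5 0 0, rmove 3 0, rconst 4 1, rconst 5 4, rconst 6 1, iconst 6 1])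
    (.loop (rle 3 5) (block [radd 3 3 0, radd 4 4 6, iadd 6 6 1]))

/-- The least positive integer `q` with `4 < q * ε`. -/
noncomputable def accuracy (ε : ℝ) : ℕ := ⌊4 / ε⌋₊ + 1

/-- Reals reach indices only through comparisons, so multiples of `ε` are compared with `4` while
`q` is counted both as an index and as a real. -/
theorem runs_findAccuracy (hε : 0 < ε) (P : Fin n → EuclideanSpace ℝ (Fin 2)) :
    Runs findAccuracy (inputState P ε) (accuracy ε * 5 + 9) fun s' =>
      Start n (inputState P ε).rmem s' ∧ s'.idx 6 = accuracy ε ∧ s'.reg 4 = accuracy ε ∧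
        s'.reg 6 = 1 := by
  rw [show accuracy ε * 5 + 9 = 8 + (accuracy ε * (4 + 1) + 1) by ring]
  refine .seq (.block (.loop (fun j s' => Start n (inputState P ε).rmem s' ∧ s'.idx 6 = j + 1 ∧
    s'.reg 0 = ε ∧ s'.reg 3 = (j + 1) * ε ∧ s'.reg 4 = j + 1 ∧ s'.reg 5 = 4 ∧ s'.reg 6 = 1 ∧
    j * ε ≤ 4) (accuracy ε) ?_ ?_ ?_))
  · simp [Start, Instr.apply, inputState, two_mul]
  · rintro j s' ⟨hs, h6, h0, h3, h4, h5, hr6, hj⟩ ht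
    simp only [Holds, h3, h5] at ht
    simp only [Start] at hs
    have : j ≤ ⌊4 / ε⌋₊ := Nat.le_floor (by rwa [le_div_iff₀ hε])
    refine ⟨by rw [accuracy]; omega, .block ?_⟩
    simp only [Start, List.foldl, Instr.apply]
    refine ⟨by simp [hs], by simp [h6, hs], by simp [h0], by simp [h0, h3]; ring, by simp [h4, hr6],
      by simp [h5], by simp [hr6], by push_cast; exact ht⟩
  · rintro j s' ⟨hs, h6, h0, h3, h4, h5, hr6, hj⟩ ht
    simp only [Holds, h3, h5, not_le] at ht
    have hfl : ⌊4 / ε⌋₊ = j := by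
      rw [Nat.floor_eq_iff (by positivity), le_div_iff₀ hε, div_lt_iff₀ hε]
      exact ⟨hj, ht⟩
    exact ⟨hs, by rw [h6, accuracy, hfl], by rw [h4, accuracy, hfl]; push_cast; rfl, hr6⟩

/-- Compute the grid size in real register `8`. -/
def findGridSize : Prog :=
  .seq (block [radd 7 4 4, radd 7 7 6, rconst 8 1, iconst 7 0])
    (.seq (.loop (ile 7 6) (block [radd 9 8 7, rmul 8 8 9, iadd 7 7 1])) (.instr (rmul 8 4 8)))

theorem runs_findGridSize {q : ℕ} (hs : Start n x s) (h6 : s.idx 6 = q) (h4 : s.reg 4 = q)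
    (hr6 : s.reg 6 = 1) :
    Runs findGridSize s (q * 5 + 12) fun s' => Start n x s' ∧ s'.reg 8 = gridSize q := by
  rw [show q * 5 + 12 = 5 + (((q + 1) * (4 + 1) + 1) + 1) by ring]
  simp only [Start] at hs
  refine .seq (.block (.seq (.loop (fun j s' => Start n x s' ∧ s'.idx 6 = q ∧ s'.idx 7 = j ∧
    s'.reg 4 = q ∧ s'.reg 7 = 2 * q + 1 ∧ s'.reg 8 = sparseBound q j ∧ j ≤ q + 1) (q + 1)
    ?_ ?_ ?_)))
  · simp [Start, Instr.apply, hs, h6, h4, hr6, sparseBound, two_mul]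
  · rintro j s' ⟨hs', h6, h7, h4, h7', h8, hj⟩ ht
    simp only [Holds, h6, h7] at ht
    simp only [Start] at hs'
    refine ⟨by omega, .block ?_⟩
    simp only [Start, List.foldl, Instr.apply]
    refine ⟨by simp [hs'], by simp [h6], by simp [h7, hs'], by simp [h4], by simp [h7'], ?_,
      by omega⟩
    -- The recursion in factored form is `b * (b + (2 * q + 1))`, with `b` the previous bound.
    simp [h7', h8, sparseBound]; ring
  · rintro j s' ⟨hs', h6, h7, h4, h7', h8, hj⟩ ht
    simp only [Holds, h6, h7] at ht
    have : j = q + 1 := by omega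
    subst this
    simp only [Start] at hs'
    refine .instr ⟨by simp [Start, Instr.apply, hs'], ?_⟩
    simp [Instr.apply, h8, h4, gridSize]

/-- Replace the content of real register `1` by the maximum with real register `a`. -/
def maxInto (a : ℕ) : Prog := .cond (rle 1 a) (.instr (rmove 1 a)) .skip

theorem runs_maxInto {a b : ℕ} {p : Prog} {Q : State → Prop}
    (h : Runs p { s with reg := Function.update s.reg 1 (max (s.reg 1) (s.reg a)) } b Q) :
    Runs (.seq (maxInto a) p) s (2 + b) Q := by
  refine .seq (.cond (fun ht => .instr ?_) fun ht => .skip ?_)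
  · rwa [max_eq_right ht] at h
  · rw [max_eq_left (not_le.1 ht).le] at h
    simpa using h

/-- Divide the extent of the point set by the grid size, with the result in real register `1`. -/
def findUnit : Prog :=
  .seq (block [rconst 1 0, rload 10 4, rload 11 1])
    (.seq (forDown 6 (.seq (block [iadd 7 6 6, rload 3 7, rsub 3 3 10, rsub 4 2 3, iadd 7 7 1,
        rload 5 7, rsub 5 5 11, rsub 6 2 5])
      (.seq (maxInto 3) (.seq (maxInto 4) (.seq (maxInto 5) (.seq (maxInto 6) .skip))))))
    (.instr (rdiv 1 1 8)))

theorem inputState_rmem_even (P : Fin n → EuclideanSpace ℝ (Fin 2)) (i : Fin n) :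
    (inputState P ε).rmem (2 * i) = P i 0 := by
  simp [inputState]

theorem inputState_rmem_odd (P : Fin n → EuclideanSpace ℝ (Fin 2)) (i : Fin n) :
    (inputState P ε).rmem (2 * i + 1) = P i 1 := by
  have h1 : (2 * (i : ℕ) + 1) / 2 = i := by omega
  have h2 : (2 * (i : ℕ) + 1) % 2 = 1 := by omega
  simp [inputState, h1, h2]

theorem abs_sub_le_dist (p p' : EuclideanSpace ℝ (Fin 2)) (k : Fin 2) :
    |p k - p' k| ≤ dist p p' := by
  rw [dist_eq_norm]
  exact PiLp.norm_apply_le (p - p') k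

/-- The maximum norm needs no square root and agrees with the Euclidean distance up to a constant,
which is all that `IsExtent` asks. -/
theorem runs_findUnit (P : Fin n → EuclideanSpace ℝ (Fin 2)) (hn : 0 < n) {g : ℝ}
    (hs : Start n (inputState P ε).rmem s) (hg : s.reg 8 = g) :
    Runs findUnit s (n * 20 + 7) fun s' => ∃ M, IsExtent P ⟨0, hn⟩ M ∧ Const n (M / g) s' ∧
      s'.idx 2 = 0 ∧ s'.idx 3 = 0 ∧ s'.rmem = (inputState P ε).rmem := by
  have hx0 : (inputState P ε).rmem 0 = P ⟨0, hn⟩ 0 := inputState_rmem_even P ⟨0, hn⟩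
  have hx1 : (inputState P ε).rmem 1 = P ⟨0, hn⟩ 1 := inputState_rmem_odd P ⟨0, hn⟩
  rw [show n * 20 + 7 = 4 + ((n * (18 + 2) + 2) + 1) by ring]
  simp only [Start] at hs
  refine .seq (.block (.seq (.forDown (fun i s' => s'.idx 6 = i ∧
    Start n (inputState P ε).rmem s' ∧ s'.reg 8 = g ∧ s'.reg 10 = P ⟨0, hn⟩ 0 ∧
    s'.reg 11 = P ⟨0, hn⟩ 1 ∧
    (∀ j : Fin n, i ≤ j → ∀ k, |P j k - P ⟨0, hn⟩ k| ≤ s'.reg 1) ∧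
    ∃ j, s'.reg 1 ≤ dist (P ⟨0, hn⟩) (P j)) (fun i s' h => ⟨h.1, h.2.1.2.1⟩) ?_ ?_ ?_)))
  · refine ⟨by simp [Instr.apply, hs], by simp [Start, Instr.apply, hs], by simp [Instr.apply, hg],
      by simp [Instr.apply, hs, hx0], by simp [Instr.apply, hs, hx1], fun j hj => ?_, ⟨0, hn⟩,
      by simp [Instr.apply]⟩
    have := j.2
    omega
  · rintro i s' hi ⟨h6, hs', h8, h10, h11, hle, j, hj⟩
    simp only [Start] at hs'
    rw [show 18 = 9 + (2 + (2 + (2 + (2 + 1)))) by rfl]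
    have hxi := inputState_rmem_even (ε := ε) P ⟨i, hi⟩
    have hyi := inputState_rmem_odd (ε := ε) P ⟨i, hi⟩
    simp only at hxi hyi
    rw [two_mul] at hxi hyi
    refine .seq (.block (runs_maxInto (runs_maxInto (runs_maxInto (runs_maxInto (.skip ?_))))))
    -- The program takes the maximum over both signs of each coordinate difference, which amounts to
    -- absolute values.
    have hreg : max (max (max (max (s'.reg 1) (P ⟨i, hi⟩ 0 - P ⟨0, hn⟩ 0))
        (-(P ⟨i, hi⟩ 0 - P ⟨0, hn⟩ 0))) (P ⟨i, hi⟩ 1 - P ⟨0, hn⟩ 1))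
        (-(P ⟨i, hi⟩ 1 - P ⟨0, hn⟩ 1)) =
        max (s'.reg 1) (max |P ⟨i, hi⟩ 0 - P ⟨0, hn⟩ 0| |P ⟨i, hi⟩ 1 - P ⟨0, hn⟩ 1|) := by
      simp only [abs, max_assoc]
    generalize hM : max (s'.reg 1) (max |P ⟨i, hi⟩ 0 - P ⟨0, hn⟩ 0|
      |P ⟨i, hi⟩ 1 - P ⟨0, hn⟩ 1|) = M at hreg
    have hle' : ∀ j : Fin n, i ≤ j → ∀ k, |P j k - P ⟨0, hn⟩ k| ≤ M := by
      intro j hij k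
      rw [← hM]
      by_cases h : j = ⟨i, hi⟩
      · subst h
        fin_cases k
        · exact le_max_of_le_right (le_max_left _ _)
        · exact le_max_of_le_right (le_max_right _ _)
      · have : (j : ℕ) ≠ i := fun h' => h (Fin.ext h')
        exact le_max_of_le_left (hle j (by omega) k)
    have hdist : ∃ j, M ≤ dist (P ⟨0, hn⟩) (P j) := by
      have hd : max |P ⟨i, hi⟩ 0 - P ⟨0, hn⟩ 0| |P ⟨i, hi⟩ 1 - P ⟨0, hn⟩ 1| ≤
          dist (P ⟨0, hn⟩) (P ⟨i, hi⟩) := by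
        rw [dist_comm]
        exact max_le (abs_sub_le_dist _ _ _) (abs_sub_le_dist _ _ _)
      rcases le_total (dist (P ⟨0, hn⟩) (P ⟨i, hi⟩)) (dist (P ⟨0, hn⟩) (P j)) with h | h
      · exact ⟨j, hM ▸ max_le hj (hd.trans h)⟩
      · exact ⟨⟨i, hi⟩, hM ▸ max_le (hj.trans h) hd⟩
    simp only [Start, List.foldl, Instr.apply]
    refine ⟨by simp [h6, hs'], by simp [hs'], by simp [h8], by simp [h10], by simp [h11], ?_, ?_⟩
    · convert hle' using 4
      simpa [h6, hs', h10, h11, hxi, hyi] using hreg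
    · convert hdist using 3
      simpa [h6, hs', h10, h11, hxi, hyi] using hreg
  · rintro s' ⟨-, hs', h8, -, -, hle, hj⟩
    simp only [Start] at hs'
    refine .instr ⟨s'.reg 1, ⟨fun i k => hle i (Nat.zero_le _) k, hj⟩, ?_⟩
    simp [Const, Instr.apply, hs', h8]

/-! ### Correctness and running time of the scheme -/

/-- The approximation scheme. -/
def scheme : Prog := .seq findAccuracy (.seq findGridSize (.seq findUnit search))

/-- Both sides of the distance condition are nonnegative, so comparing squares avoids roots. -/
theorem memAdj_trial_iff (P : Fin n → EuclideanSpace ℝ (Fin 2)) {μ : ℝ} (hμ : 0 ≤ μ) (t : ℕ)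
    (u v : Fin n) : MemAdj n (trial n μ (inputState P ε).rmem t) u v ↔
      dist (P u) (P v) ≤ μ * digitCount n t u + μ * digitCount n t v := by
  have hu := u.2
  have hv := v.2
  have h1 : 2 * (u : ℕ) + 1 < 2 * n := by omega
  have h2 : 2 * (v : ℕ) + 1 < 2 * n := by omega
  simp only [MemAdj, trial, Nat.mul_lt_mul_left two_pos, hu, hv, h1, h2, if_true,
    inputState_rmem_even, inputState_rmem_odd, Nat.not_lt.2 (Nat.le_add_right (2 * n) _), if_false,
    Nat.add_sub_cancel_left]
  rw [← sq, ← sq, ← sq, ← dist_sq_eq, sq_le_sq₀ dist_nonneg (by positivity)]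

theorem isFeasible_of_level (P : Fin n → EuclideanSpace ℝ (Fin 2)) (hn : 0 < n) {μ : ℝ}
    (hμ : 0 ≤ μ) {t : ℕ}
    (h : ∀ v < n, ∃ j, Level n (trial n μ (inputState P ε).rmem t) j v) :
    IsFeasible P fun i => μ * digitCount n t i := by
  have key : ∀ j (v : Fin n), Level n (trial n μ (inputState P ε).rmem t) j v →
      (connectivityGraph P fun i => μ * digitCount n t i).Reachable ⟨0, hn⟩ v := by
    intro j
    induction j with
    | zero =>
      intro v hv
      rw [show v = ⟨0, hn⟩ from Fin.ext hv]
    | succ j ih =>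
      rintro v (hv | ⟨u, hu, hl, huv⟩)
      · exact ih v hv
      · refine (ih ⟨u, hu⟩ hl).trans ?_
        -- `MemAdj` does not exclude equal indices, unlike adjacency in the graph.
        by_cases hne : (⟨u, hu⟩ : Fin n) = v
        · rw [hne]
        · exact SimpleGraph.Adj.reachable ⟨hne, (memAdj_trial_iff P hμ t ⟨u, hu⟩ v).1 huv⟩
  have key' : ∀ v, (connectivityGraph P fun i => μ * digitCount n t i).Reachable ⟨0, hn⟩ v :=
    fun v => by
      obtain ⟨j, hj⟩ := h v v.2
      exact key j v hj
  have : Nonempty (Fin n) := ⟨⟨0, hn⟩⟩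
  exact ⟨fun i => by positivity, ⟨fun u v => (key' u).symm.trans (key' v)⟩⟩

theorem level_mono (n : ℕ) (m : ℕ → ℝ) : Monotone (Level n m) :=
  monotone_nat_of_le_succ fun _ _ h => .inl h

/-- Each edge of a walk raises the level by at most one, and a path on `n` vertices has fewer than
`n` edges. -/
theorem level_of_isFeasible (P : Fin n → EuclideanSpace ℝ (Fin 2)) (hn : 0 < n) {μ : ℝ}
    (hμ : 0 ≤ μ) {t : ℕ} (h : IsFeasible P fun i => μ * digitCount n t i) :
    ∀ v < n, Level n (trial n μ (inputState P ε).rmem t) n v := by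
  have key : ∀ (u v : Fin n) (w : (connectivityGraph P fun i => μ * digitCount n t i).Walk u v)
      (j : ℕ), Level n (trial n μ (inputState P ε).rmem t) j u →
      Level n (trial n μ (inputState P ε).rmem t) (j + w.length) v := by
    intro u v w
    induction w with
    | nil => exact fun j h => h
    | @cons u u' v hadj w ih =>
      intro j hj
      have := ih (j + 1) (hj.step u.2 ((memAdj_trial_iff P hμ t u u').2 hadj.2))
      rwa [SimpleGraph.Walk.length_cons, add_comm w.length, ← add_assoc]
  intro v hv
  obtain ⟨w, hw⟩ := (h.2.preconnected ⟨0, hn⟩ ⟨v, hv⟩).exists_isPath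
  have hlen := hw.length_lt
  rw [Fintype.card_fin] at hlen
  exact level_mono _ _ (by omega) _ (key _ _ w 0 rfl)

theorem scheme_spec {ε : ℝ} (hε : 0 < ε) : ∃ T : Polynomial ℕ, ∀ n : ℕ, 0 < n →
    ∀ P : Fin n → EuclideanSpace ℝ (Fin 2), ∃ (s : State) (k : ℕ),
      Exec scheme (inputState P ε) s k ∧ k ≤ T.eval n ∧ IsFeasible P (output n s) ∧
      ∀ r : Fin n → ℝ, IsFeasible P r → ∑ i, output n s i ≤ (1 + ε) * ∑ i, r i := by
  obtain ⟨q, hq⟩ : ∃ q, q = accuracy ε := ⟨_, rfl⟩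
  have hq0 : 0 < q := by rw [hq, accuracy]; omega
  have hqε : 4 / (q : ℝ) ≤ ε := by
    have : 4 / ε < q := by rw [hq, accuracy]; exact_mod_cast Nat.lt_floor_add_one (4 / ε)
    rw [div_le_iff₀ (by exact_mod_cast hq0)]
    rw [div_lt_iff₀ hε] at this
    linarith
  let X : Polynomial ℕ := Polynomial.X
  -- `Y` bounds the number of a feasible trial; its exponent depends on `ε` alone.
  let Y : Polynomial ℕ := (X + 1) ^ (2 * gridSize q)
  refine ⟨(Polynomial.C (q * 5 + 9) + (Polynomial.C (q * 5 + 12) + ((X * 20 + 7) +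
    ((Y + 1) * (Y * (Y * 4 + 10) + X * (X * (X * 24 + 6) + 4) + X * 14 + 14) + 1)))), ?_⟩
  intro n hn P
  have hrun : Runs scheme (inputState P ε) ((q * 5 + 9) + ((q * 5 + 12) + ((n * 20 + 7) +
      (((n + 1) ^ (2 * gridSize q) + 1) * ((n + 1) ^ (2 * gridSize q) *
        ((n + 1) ^ (2 * gridSize q) * 4 + 10) + n * (n * (n * 24 + 6) + 4) + n * 14 + 14) + 1))))
      fun s => IsFeasible P (output n s) ∧
        ∀ r : Fin n → ℝ, IsFeasible P r → ∑ i, output n s i ≤ (1 + ε) * ∑ i, r i := by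
    refine .seq ((hq ▸ runs_findAccuracy hε P).mono le_rfl ?_)
    rintro s₁ ⟨hs₁, h6, h4, hr6⟩
    refine .seq ((runs_findGridSize hs₁ h6 h4 hr6).mono le_rfl ?_)
    rintro s₂ ⟨hs₂, h8⟩
    refine .seq ((runs_findUnit P hn hs₂ h8).mono le_rfl ?_)
    rintro s₃ ⟨M, hM, hc, h2, h3, hx⟩
    have hμ : 0 ≤ M / gridSize q := div_nonneg hM.nonneg (Nat.cast_nonneg _)
    have hfeas : ∀ (a : Fin n → ℕ) (t : ℕ), (∀ i : Fin n, digitCount n t i = a i) →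
        (IsFeasible P fun i => M / gridSize q * a i) →
        ∀ v < n, Level n (trial n (M / gridSize q) (inputState P ε).rmem t) n v :=
      fun a t hta ha => level_of_isFeasible P hn hμ (by simpa only [hta] using ha)
    obtain ⟨a, hasum, ha⟩ := hM.exists_grid_feasible hq0
    obtain ⟨t₀, ht₀, hta⟩ := exists_digitCount_eq hn _ a hasum
    refine (runs_search hn hc (fun i _ => by rw [hx]) h2 h3 (hfeas a t₀ hta ha)).mono ?_ ?_
    · have ht₁ : t₀ ≤ (n + 1) ^ (2 * gridSize q) := by omega
      gcongr
    rintro s' ⟨t, hlev, hmin, hout⟩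
    have hout' : output n s' = fun i : Fin n => M / gridSize q * digitCount n t i :=
      funext fun i => hout i i.2
    rw [hout']
    refine ⟨isFeasible_of_level P hn hμ hlev, fun r hr => ?_⟩
    obtain ⟨a', ha', hsum'⟩ := hM.exists_grid_approx hq0 hr
    -- No bound on `t'` is needed: the trial found comes no later than `t'`, hence uses no more
    -- units than the rounded near-optimal solution.
    obtain ⟨t', -, hta'⟩ := exists_digitCount_eq hn _ a' rfl
    have hlen := digitLength_mono n (hmin t' (hfeas a' t' hta' ha'))
    rw [← sum_digitCount hn, ← sum_digitCount hn] at hlen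
    simp only [hta'] at hlen
    calc ∑ i : Fin n, M / gridSize q * (digitCount n t i : ℝ)
        ≤ ∑ i, M / gridSize q * (a' i : ℝ) := by
          rw [← Finset.mul_sum, ← Finset.mul_sum]
          exact mul_le_mul_of_nonneg_left (by exact_mod_cast hlen) hμ
      _ ≤ (1 + 4 / q) * ∑ i, r i := hsum'
      _ ≤ (1 + ε) * ∑ i, r i := by
          have : 0 ≤ ∑ i, r i := Finset.sum_nonneg fun i _ => hr.1 i
          gcongr
  obtain ⟨s, k, hk, hkb, h⟩ := hrun
  refine ⟨s, k, hk, hkb.trans (le_of_eq ?_), h⟩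
  simp [X, Y]

end RealRAM

theorem theorem8 :
    ∃ prog : RealRAM.Prog, ∀ ε : ℝ, 0 < ε → ∃ T : Polynomial ℕ,
      ∀ n : ℕ, 0 < n → ∀ P : Fin n → EuclideanSpace ℝ (Fin 2),
        ∃ (s : RealRAM.State) (k : ℕ),
          RealRAM.Exec prog (RealRAM.inputState P ε) s k ∧
          k ≤ T.eval n ∧
          IsFeasible P (RealRAM.output n s) ∧
          ∀ r : Fin n → ℝ, IsFeasible P r →
            ∑ i, RealRAM.output n s i ≤ (1 + ε) * ∑ i, r i :=
  ⟨RealRAM.scheme, fun _ hε => RealRAM.scheme_spec hε⟩
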